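/- **Setting.** Let $p$ be an odd prime and $\phi,\psi\in\mathbb{F}_p$ (arbitrary). Let $\Delta=\{v\in\mathbb{R}^5_{\ge 0}: v_1+v_2+2(v_3+v_4+v_5)=8\}$ be the Newton polyhedron of degree-8 polynomials on $\mathbb{P}^{(1,1,2,2,2)}$. It has $105$ lattice points: the interior point $(1,1,1,1,1)$ and $104$ boundary points $\mathbf m$, to each of which we attach a Cox variable $\tilde x_{\mathbf m}$. Fix any triangulation of $\partial\Delta$ whose set of vertices is the set of all $104$ boundary lattice points, and let $X_\Sigma=(\mathbb{A}^{104}\setminus F)/\mathbb{G}_m^{100}$ be the toric variety whose fan consists of the cones, with apex $(1,1,1,1,1)$, over the simplices: coordinates may vanish simultaneously at a point outside $F$ if and only if the corresponding $\mathbf m$ belong to one simplex, and $\mathbb{G}_m^{100}$ is realised as the group of all $g=(g_{\mathbf m})$ with $\prod_{\mathbf m}g_{\mathbf m}^{m_j-1}=1$ for $j=1,\dots,5$, acting by $(g\cdot\tilde x)_{\mathbf m}=g_{\mathbf m}\tilde x_{\mathbf m}$. The mirror octic is the hypersurface in $X_\Sigma$ given by $$\tilde P(\tilde x)=\sum_{j=1}^5\prod_{\mathbf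 m}\tilde x_{\mathbf m}^{m_j}-2\phi\prod_{\mathbf m}\tilde x_{\mathbf m}^{(m_1+m_2)/2}-8\psi\prod_{\mathbf m}\tilde x_{\mathbf m}=0 .$$ For $q=p^s$, $s\ge1$, let $\tilde N_s$ be the number of its $\mathbb{F}_q$-points, i.e. the number of orbits of the group of $\mathbb{F}_q$-points $g$ as above on the solutions $\tilde x\in\mathbb{F}_q^{104}\setminus F$ of $\tilde P(\tilde x)=0$. Let $\mathbb{K}$ be a field of characteristic $0$, $\Theta:\mathbb{F}_q\to\mathbb{K}^\times$ any nontrivial additive character and $\omega:\mathbb{F}_q^\times\to\mathbb{K}^\times$ any injective character (for instance $\mathbb{K}=\mathbb{C}_p$ with Dwork's character and the Teichmüller character). Put $G_n(c)=\sum_{x\in\mathbb{F}_q^\times}\Theta(cx)\,\omega(x)^n$ and $G_n=G_n(1)$, so that $G_n(c)=\omega(c)^{-n}G_n$ for $c\ne0$, and let $$N_{(0,0,0,0,0),s}=\frac1{q(q-1)^2}\sum_{t=0}^{q-2}\sum_{u=0}^{q-2}G_{-u}^2\,G_{-t}^3\,G_{2u-t}(-2\phi)\,G_{4t}(-8\psi)+\frac1{q(q-1)}\sum_{u=0}^{q-2}G_{-u}^2\,G_{2u}(-2\phi),$$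 the contribution of the monomial class $(0,0,0,0,0)$. Write $\chi=\left(\frac{\phi^2-1}{p}\right)\in\{0,1,-1\}$ for the Legendre symbol. **Theorem.** (a) For every $s\ge1$, with $q=p^s$, $$\tilde N_s=1+83q+83q^2+q^3+N_{(0,0,0,0,0),s}+3q(q+1)\chi^s .$$ (b) Consequently, let $\tilde\zeta(t)=\exp\Big(\sum_{s\ge1}\tilde N_s\frac{t^s}{s}\Big)$ be the zeta function of the mirror, and let $R_{(0,0,0,0,0)}(t)=\exp\Big(\sum_{s\ge1}N_{(0,0,0,0,0),s}\frac{t^s}{s}\Big)$ be the contribution of the class $(0,0,0,0,0)$ to the zeta function, formed with any choice of characters $\Theta,\omega$ over each $\mathbb{F}_{p^s}$. Then, as formal power series over $\mathbb{K}$, $$\tilde\zeta(t)=\frac{R_{(0,0,0,0,0)}(t)}{(1-t)(1-pt)^{83}(1-p^2t)^{83}(1-\chi pt)^3(1-\chi p^2t)^3(1-p^3t)} .$$ -/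

import Mathlib

open PowerSeries

noncomputable section

namespace MirrorOctic

/-! ### The Newton polyhedron and its triangulations -/

/-- The monomials `x₁^m₁ ⋯ x₅^m₅` of degree `8` in the variables of `ℙ^(1,1,2,2,2)`, other than the
interior point `(1,1,1,1,1)` of the Newton polyhedron. They are the rays of the mirror fan.
(The bound `m i < 9` is automatic, see `mem_coxMonomials`.) -/
def coxMonomials : Finset (Fin 5 → ℕ) :=
  (Fintype.piFinset fun _ => Finset.range 9).filter fun m =>
    m 0 + m 1 + 2 * (m 2 + m 3 + m 4) = 8 ∧ m ≠ 1

theorem mem_coxMonomials (m : Fin 5 → ℕ) :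
    m ∈ coxMonomials ↔ m 0 + m 1 + 2 * (m 2 + m 3 + m 4) = 8 ∧ m ≠ 1 := by
  simp only [coxMonomials, Finset.mem_filter, Fintype.mem_piFinset, Finset.mem_range,
    and_iff_right_iff_imp]
  rintro ⟨h, -⟩ i
  fin_cases i <;> simp <;> omega

/-- The index type of the `104` Cox variables of the mirror. -/
abbrev CoxVar : Type := coxMonomials

/-- A Cox variable as a point of the Newton polyhedron in `ℝ⁵`. -/
def CoxVar.toPoint (m : CoxVar) : Fin 5 → ℝ := fun i => (m.1 i : ℝ)

/-- The boundary of the Newton polyhedron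
`{v | 0 ≤ vᵢ, v₁ + v₂ + 2 (v₃ + v₄ + v₅) = 8}` (a four-dimensional simplex). -/
def newtonBoundary : Set (Fin 5 → ℝ) :=
  {v | (∀ i, 0 ≤ v i) ∧ v 0 + v 1 + 2 * (v 2 + v 3 + v 4) = 8 ∧ ∃ i, v i = 0}

/-- `K` is a triangulation of the boundary of the Newton polyhedron whose vertices are all the
lattice points of the boundary. The cones from the interior point `(1,1,1,1,1)` over the simplices
of `K`, with the zero cone, form the fan of a maximal crepant partial resolution. -/
structure IsFineTriangulation (K : Geometry.SimplicialComplex ℝ (Fin 5 → ℝ)) : Prop where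
  vertices_eq : K.vertices = Set.range CoxVar.toPoint
  space_eq : K.space = newtonBoundary

/-! ### The mirror hypersurface in Cox coordinates -/

section Points

variable {F : Type*} [Field F]

/-- The mirror polynomial
`x^{w₁} + x^{w₂} + x^{w₃} + x^{w₄} + x^{w₅} - 2 φ x^{w_φ} - 8 ψ x^{w_ψ}`, where
`x^{w_j} = ∏ₘ xₘ^{m_j}`, `m_φ = (m₁ + m₂) / 2` (an exact division) and `m_ψ = 1`. -/
def mirrorPoly (φ ψ : F) (x : CoxVar → F) : F :=
  (∑ j : Fin 5, ∏ m, x m ^ m.1 j) - 2 * φ * ∏ m, x m ^ ((m.1 0 + m.1 1) / 2)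
    - 8 * ψ * ∏ m, x m

/-- `x` lies outside the exceptional set: the coordinates that vanish at `x` belong to one cone of
the fan. -/
def IsAdmissible (K : Geometry.SimplicialComplex ℝ (Fin 5 → ℝ)) (x : CoxVar → F) : Prop :=
  ∃ σ ∈ K.faces, ∀ m, x m = 0 → m.toPoint ∈ σ

variable (F) in
/-- The group by which the toric variety is a quotient: all `g` with
`∏ₘ gₘ^⟨e, m - (1,1,1,1,1)⟩ = 1` for every character `e` of the torus of the toric variety. These
characters are generated by the five coordinates. It is a torus of dimension `100`. -/
def coxGroup : Subgroup (CoxVar → Fˣ) where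
  carrier := {g | ∀ j : Fin 5, ∏ m, g m ^ ((m.1 j : ℤ) - 1) = 1}
  one_mem' := by simp
  mul_mem' := by
    intro a b ha hb j
    simp only [Pi.mul_apply, mul_zpow, Finset.prod_mul_distrib, ha j, hb j, mul_one]
  inv_mem' := by
    intro a ha j
    simp only [Pi.inv_apply, inv_zpow, Finset.prod_inv_distrib, ha j, inv_one]

/-- The Cox coordinates of the points of the mirror hypersurface. -/
def mirrorCone (K : Geometry.SimplicialComplex ℝ (Fin 5 → ℝ)) (φ ψ : F) : Set (CoxVar → F) :=
  {x | IsAdmissible K x ∧ mirrorPoly φ ψ x = 0}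

/-- The number of `F`-points of the mirror octic: the number of orbits of `coxGroup F`, which acts
by `(g • x)ₘ = gₘ xₘ`, on the Cox coordinates of points of the hypersurface. -/
def mirrorCount (K : Geometry.SimplicialComplex ℝ (Fin 5 → ℝ)) (φ ψ : F) : ℕ :=
  Set.ncard ((fun x => MulAction.orbit (coxGroup F) x) '' mirrorCone K φ ψ)

end Points

/-! ### Gauss sums and the contribution of the monomial `(0,0,0,0,0)` -/

section Gauss

variable {F : Type*} [Field F] [Fintype F] {𝕂 : Type*} [Field 𝕂]

/-- The Gauss sum `G_n(c) = ∑_{x ∈ Fˣ} Θ(c x) ω(x)^n`. -/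
def gauss (Θ : AddChar F 𝕂) (ω : Fˣ →* 𝕂ˣ) (c : F) (n : ℤ) : 𝕂 :=
  letI := Fintype.ofFinite Fˣ
  ∑ x : Fˣ, Θ (c * x) * ((ω x ^ n : 𝕂ˣ) : 𝕂)

/-- For `c ≠ 0` one has `G_n(c) = G_n · ω(c)^{-n}` with the usual Gauss sum `G_n = G_n(1)`. -/
theorem gauss_unit (Θ : AddChar F 𝕂) (ω : Fˣ →* 𝕂ˣ) (c : Fˣ) (n : ℤ) :
    gauss Θ ω (c : F) n = gauss Θ ω 1 n * ((ω c ^ (-n) : 𝕂ˣ) : 𝕂) := by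
  unfold gauss
  let _ := Fintype.ofFinite Fˣ
  rw [Finset.sum_mul]
  refine Fintype.sum_equiv (Equiv.mulLeft c) _ _ fun x => ?_
  have h : ω (c * x) ^ n * ω c ^ (-n) = ω x ^ n := by
    rw [map_mul, mul_zpow, zpow_neg, mul_comm (ω c ^ n), mul_inv_cancel_right]
  rw [Equiv.coe_mulLeft, one_mul, mul_assoc, ← Units.val_mul (ω (c * x) ^ n), h, Units.val_mul]

/-- The contribution `N_(0,0,0,0,0)` of the class of the monomial `(0,0,0,0,0)` to the number of
`F`-points, `q = #F`:
`1/(q(q-1)²) ∑_{t,u} G_{-u}² G_{-t}³ G_{2u-t}(-2φ) G_{4t}(-8ψ) + 1/(q(q-1)) ∑_u G_{-u}² G_{2u}(-2φ)`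
with `t` and `u` running over the residues modulo `q - 1`. -/
def N0 (Θ : AddChar F 𝕂) (ω : Fˣ →* 𝕂ˣ) (φ ψ : F) : 𝕂 :=
  let q : ℕ := Fintype.card F
  1 / ((q : 𝕂) * ((q : 𝕂) - 1) ^ 2) *
      ∑ t ∈ Finset.range (q - 1), ∑ u ∈ Finset.range (q - 1),
        gauss Θ ω 1 (-u) ^ 2 * gauss Θ ω 1 (-t) ^ 3 *
          gauss Θ ω (-2 * φ) (2 * u - t) * gauss Θ ω (-8 * ψ) (4 * t) +
    1 / ((q : 𝕂) * ((q : 𝕂) - 1)) *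
      ∑ u ∈ Finset.range (q - 1), gauss Θ ω 1 (-u) ^ 2 * gauss Θ ω (-2 * φ) (2 * u)

end Gauss

/-! ### Zeta functions -/

/-- The power series `exp (∑_{s ≥ 1} N_s t^s / s)`. -/
def zetaSeries {𝕂 : Type*} [Field 𝕂] [CharZero 𝕂] (N : ℕ → 𝕂) : 𝕂⟦X⟧ :=
  (PowerSeries.exp 𝕂).subst (PowerSeries.mk fun s => if s = 0 then 0 else N s / (s : 𝕂))

end MirrorOctic

end

noncomputable section

namespace MirrorOctic

/-! ### Zeta series -/

section Zeta

variable {𝕂 : Type*} [Field 𝕂]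

/-! The Cox group acts freely on the admissible solutions, so the number of points is the number of
these solutions divided by the order of the group (`mirrorCount_mul_card`). Solutions are sorted by
the set `τ` of vanishing coordinates, which is empty or a simplex, and simplices by the set `J` of
coordinates of `ℝ⁵` vanishing on `τ`, i.e. by the smallest face of the Newton polyhedron containing
`τ`.

For `τ = ∅` one counts zeros on a torus. Orthogonality of characters unfolds the Gauss sums in `N0`
into an exponential sum over the same torus, so `N0` is this count up to explicit terms (`N0_eq`).

For a simplex the polynomial reduces to `facePoly J`. Unless `J` contains both coordinates of weight
one, this is a sum of independent monomials with unit values, and its zeros are counted by a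
polynomial in `q`. If `J ≠ univ` contains both, the relation `coordMonomial 0 * coordMonomial 1 =
midMonomial ^ 2` produces the conic `a + c ^ 2 / a - 2 φ c`, which has `1 + χ` zeros for each `c`;
only such conics, here and inside `N0`, bring in `χ`. If `J` is a single coordinate, one
nonvanishing monomial is left and there is no solution. Hence `2 ≤ J.card`, and `τ` has at most
three vertices.

It remains to see that the number of such simplices does not depend on the triangulation. Simplices
with at most three vertices are unimodular (`integral_of_sum_integral`). This gives the freeness of
the action, and it makes every lattice point interior to a multiple of a face of dimension at most
two a unique positive integral combination of the vertices of one simplex (`card_latticePoints`).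
Lattice point counts in degrees `8`, `16`, `24` then determine the numbers of vertices, edges and
triangles.

Part (b) follows formally, since `zetaSeries` turns sums into products and `a ^ s` into `1 / (1 - a
t)`. -/

theorem hasSubst_zeta_log (N : ℕ → 𝕂) :
    HasSubst (PowerSeries.mk fun s => if s = 0 then 0 else N s / (s : 𝕂)) :=
  HasSubst.of_constantCoeff_zero' (by simp [← coeff_zero_eq_constantCoeff_apply])

variable [CharZero 𝕂]

theorem constantCoeff_zetaSeries (N : ℕ → 𝕂) : constantCoeff (zetaSeries N) = 1 := by
  have h : constantCoeff (PowerSeries.mk fun s => if s = 0 then 0 else N s / (s : 𝕂)) = 0 := by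
    simp [← coeff_zero_eq_constantCoeff_apply]
  have h1 := constantCoeff_subst_eq_zero (a := (PowerSeries.mk fun s =>
    if s = 0 then 0 else N s / (s : 𝕂))) h (PowerSeries.exp 𝕂 - 1) (by simp)
  rw [subst_sub (hasSubst_zeta_log N)] at h1
  have h2 : (1 : 𝕂⟦X⟧).subst (PowerSeries.mk fun s => if s = 0 then 0 else N s / (s : 𝕂))
      = (1 : 𝕂⟦X⟧) := by
    rw [← coe_substAlgHom (hasSubst_zeta_log N), map_one]
  rw [h2, map_sub, sub_eq_zero, map_one] at h1
  exact h1

/-- The chain rule cancels the denominators `s`. Identities between zeta series thus become linear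
identities between their logarithmic derivatives, with no formal logarithm needed. -/
theorem derivative_zetaSeries (N : ℕ → 𝕂) :
    d⁄dX 𝕂 (zetaSeries N) = zetaSeries N * PowerSeries.mk fun s => N (s + 1) := by
  unfold zetaSeries
  rw [derivative_subst (hasSubst_zeta_log N), derivative_exp]
  congr 1
  ext n
  have : (n : 𝕂) + 1 ≠ 0 := by exact_mod_cast n.succ_ne_zero
  simp [coeff_derivative, this]

/-- The quotient `f * g⁻¹` has derivative zero and constant term one, so it is `1` in characteristic
zero. -/
theorem eq_of_logDerivative_eq {f g h : 𝕂⟦X⟧} (hf : d⁄dX 𝕂 f = f * h) (hg : d⁄dX 𝕂 g = g * h)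
    (hf1 : constantCoeff f = 1) (hg1 : constantCoeff g = 1) : f = g := by
  have hg0 : g * g⁻¹ = 1 := PowerSeries.mul_inv_cancel g (by simp [hg1])
  have key : f * g⁻¹ = 1 := by
    apply derivative.ext (R := 𝕂)
    · rw [Derivation.leibniz, derivative_inv', hf, hg, derivative_one, smul_eq_mul, smul_eq_mul]
      linear_combination (-f * h * g⁻¹) * hg0
    · rw [map_mul, hf1, constantCoeff_inv, hg1]; simp
  calc f = f * (g * g⁻¹) := by rw [hg0, mul_one]
    _ = (f * g⁻¹) * g := by ring
    _ = g := by rw [key, one_mul]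

theorem zetaSeries_add (M N : ℕ → 𝕂) :
    zetaSeries (fun s => M s + N s) = zetaSeries M * zetaSeries N := by
  refine eq_of_logDerivative_eq (derivative_zetaSeries _) ?_ (constantCoeff_zetaSeries _)
    (by rw [map_mul, constantCoeff_zetaSeries, constantCoeff_zetaSeries, one_mul])
  have h : (PowerSeries.mk fun s => M (s + 1) + N (s + 1)) =
      (PowerSeries.mk fun s => M (s + 1)) + PowerSeries.mk fun s => N (s + 1) := by
    ext; simp
  rw [Derivation.leibniz, derivative_zetaSeries, derivative_zetaSeries, smul_eq_mul, smul_eq_mul, h]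
  ring

theorem zetaSeries_zero : zetaSeries (fun _ => (0 : 𝕂)) = 1 := by
  refine eq_of_logDerivative_eq (derivative_zetaSeries _) (h := _) ?_ (constantCoeff_zetaSeries _)
    (by simp)
  have h : (PowerSeries.mk fun _ => (0 : 𝕂)) = 0 := by ext; simp
  rw [derivative_one, h, mul_zero]

theorem zetaSeries_nat_mul (k : ℕ) (N : ℕ → 𝕂) :
    zetaSeries (fun s => (k : 𝕂) * N s) = zetaSeries N ^ k := by
  induction k with
  | zero => simpa using zetaSeries_zero (𝕂 := 𝕂)
  | succ k ih =>
    rw [pow_succ, ← ih, ← zetaSeries_add]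
    congr 1
    ext s
    push_cast
    ring

theorem zetaSeries_pow_mul (a : 𝕂) : zetaSeries (fun s => a ^ s) * (1 - C a * X) = 1 := by
  apply derivative.ext (R := 𝕂)
  · have h : (PowerSeries.mk fun s => a ^ (s + 1)) * (1 - C a * X) = C a := by
      ext n
      rw [mul_sub, mul_one, mul_comm (C a), ← mul_assoc, map_sub, coeff_mul_C, coeff_C]
      cases n with
      | zero => simp
      | succ n => rw [coeff_succ_mul_X]; simp; ring
    rw [Derivation.leibniz, derivative_zetaSeries, derivative_one, map_sub, derivative_one,
      Derivation.leibniz, derivative_C, derivative_X]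
    simp only [smul_eq_mul]
    linear_combination zetaSeries (fun s => a ^ s) * h
  · rw [map_mul, constantCoeff_zetaSeries]; simp

/-- The value at `s = 0` never enters, so point counts need only be compared for `s ≥ 1`. -/
theorem zetaSeries_congr {M N : ℕ → 𝕂} (h : ∀ s, 1 ≤ s → M s = N s) :
    zetaSeries M = zetaSeries N := by
  unfold zetaSeries
  congr 2
  ext s
  by_cases hs : s = 0
  · simp [hs]
  · simp [hs, h s (Nat.one_le_iff_ne_zero.2 hs)]

/-- The passage from the point counts to the zeta functions. -/
theorem zetaSeries_mul_eq_of_count {M N : ℕ → 𝕂} (p χ : 𝕂)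
    (h : ∀ s, 1 ≤ s → M s = 1 + 83 * p ^ s + 83 * (p ^ s) ^ 2 + (p ^ s) ^ 3 + N s +
      3 * p ^ s * (p ^ s + 1) * χ ^ s) :
    zetaSeries M * ((1 - X) * (1 - C p * X) ^ 83 * (1 - C p ^ 2 * X) ^ 83 *
      (1 - C χ * C p * X) ^ 3 * (1 - C χ * C p ^ 2 * X) ^ 3 * (1 - C p ^ 3 * X)) =
      zetaSeries N := by
  have e : zetaSeries M = zetaSeries N * zetaSeries (fun s => (1 : 𝕂) ^ s) *
      zetaSeries (fun s => p ^ s) ^ 83 * zetaSeries (fun s => (p ^ 2) ^ s) ^ 83 *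
      zetaSeries (fun s => (χ * p) ^ s) ^ 3 * zetaSeries (fun s => (χ * p ^ 2) ^ s) ^ 3 *
      zetaSeries (fun s => (p ^ 3) ^ s) := by
    rw [← zetaSeries_nat_mul, ← zetaSeries_nat_mul, ← zetaSeries_nat_mul, ← zetaSeries_nat_mul,
      ← zetaSeries_add, ← zetaSeries_add, ← zetaSeries_add, ← zetaSeries_add, ← zetaSeries_add,
      ← zetaSeries_add]
    refine zetaSeries_congr fun s hs => ?_
    rw [h s hs]
    simp only [one_pow, mul_pow, ← pow_mul]
    push_cast
    ring
  have h1 := zetaSeries_pow_mul (1 : 𝕂)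
  have h2 := zetaSeries_pow_mul p
  have h3 := zetaSeries_pow_mul (p ^ 2)
  have h4 := zetaSeries_pow_mul (χ * p)
  have h5 := zetaSeries_pow_mul (χ * p ^ 2)
  have h6 := zetaSeries_pow_mul (p ^ 3)
  simp only [map_one, map_mul, map_pow, one_mul] at h1 h2 h3 h4 h5 h6
  rw [e]
  generalize zetaSeries (fun s => (1 : 𝕂) ^ s) = z1 at *
  generalize zetaSeries (fun s => p ^ s) = z2 at *
  generalize zetaSeries (fun s => (p ^ 2) ^ s) = z3 at *
  generalize zetaSeries (fun s => (χ * p) ^ s) = z4 at *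
  generalize zetaSeries (fun s => (χ * p ^ 2) ^ s) = z5 at *
  generalize zetaSeries (fun s => (p ^ 3) ^ s) = z6 at *
  have rearrange : ∀ a b1 b2 b3 b4 b5 b6 c1 c2 c3 c4 c5 c6 : 𝕂⟦X⟧, a * b1 * b2 ^ 83 * b3 ^ 83 *
      b4 ^ 3 * b5 ^ 3 * b6 * (c1 * c2 ^ 83 * c3 ^ 83 * c4 ^ 3 * c5 ^ 3 * c6) =
      a * (b1 * c1) * (b2 * c2) ^ 83 * (b3 * c3) ^ 83 * (b4 * c4) ^ 3 * (b5 * c5) ^ 3 *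
        (b6 * c6) := by
    intros
    simp only [mul_pow]
    ac_rfl
  rw [rearrange, h2, h3, h4, h5, h6]
  simp [h1]

end Zeta

/-! ### Counting solutions in units -/

section Fibres

/-- All fibres of a surjective homomorphism have the same size. -/
theorem card_filter_hom_mul_card {G H : Type*} [Group G] [Group H] [Fintype G] [Fintype H]
    (f : G →* H) (hf : Function.Surjective f) (P : H → Prop) [DecidablePred P] :
    (Finset.univ.filter fun x => P (f x)).card * Fintype.card H =
      (Finset.univ.filter P).card * Fintype.card G := by
  classical
  have hfib : ∀ h : H, (Finset.univ.filter fun x => f x = h).card =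
      (Finset.univ.filter fun x => f x = 1).card := fun h =>
    MonoidHom.card_fiber_eq_of_mem_range f (hf h) (hf 1)
  have key : ∀ (R : H → Prop) [DecidablePred R], (Finset.univ.filter fun x => R (f x)).card =
      (Finset.univ.filter R).card * (Finset.univ.filter fun x => f x = 1).card := by
    intro R _
    rw [Finset.card_eq_sum_card_fiberwise (f := f) (t := Finset.univ.filter R)
      (fun x hx => by simpa using hx)]
    rw [Finset.sum_congr rfl (g := fun _ => (Finset.univ.filter fun x => f x = 1).card),
      Finset.sum_const, smul_eq_mul]
    intro h hh
    rw [← hfib h]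
    congr 1
    ext x
    simp only [Finset.mem_filter, Finset.mem_univ, true_and] at hh ⊢
    exact ⟨fun hx => hx.2, fun hx => ⟨hx ▸ hh, hx⟩⟩
  have hG := key fun _ => True
  simp only [Finset.filter_true, Finset.card_univ] at hG
  rw [key P, hG]
  ring

/-- The monomial with exponents `e`, as a homomorphism. -/
def monomialHom {ι A : Type*} [Fintype ι] [CommGroup A] (e : ι → ℕ) : (ι → A) →* A where
  toFun u := ∏ i, u i ^ e i
  map_one' := by simp
  map_mul' u v := by simp [mul_pow, Finset.prod_mul_distrib]

theorem monomialHom_apply {ι A : Type*} [Fintype ι] [CommGroup A] (e : ι → ℕ) (u : ι → A) :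
    monomialHom e u = ∏ i, u i ^ e i := rfl

theorem monomialHom_mulSingle {ι A : Type*} [Fintype ι] [DecidableEq ι] [CommGroup A]
    (e : ι → ℕ) (i : ι) (a : A) : monomialHom e (Pi.mulSingle i a) = a ^ e i := by
  rw [monomialHom_apply, Finset.prod_eq_single i]
  · rw [Pi.mulSingle_eq_same]
  · intro j _ hj
    rw [Pi.mulSingle_eq_of_ne hj, one_pow]
  · simp

end Fibres

section Units

variable {F : Type*} [Field F] [Fintype F]

open Classical in
theorem card_units_cast_add_one (R : Type*) [Ring R] :
    (Fintype.card Fˣ : R) + 1 = Fintype.card F := by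
  rw [Fintype.card_units, Nat.cast_sub Fintype.card_pos]
  simp

open Classical in
/-- The number of `y ∈ (Fˣ)^k` with `v + ∑ yᵢ = 0`. -/
theorem card_add_sum_units_eq_zero_fin (k : ℕ) (v : F) :
    ((Fintype.card F : ℤ)) * (Finset.univ.filter fun y : Fin k → Fˣ =>
      v + ∑ i, (y i : F) = 0).card = (Fintype.card Fˣ : ℤ) ^ k +
        if v = 0 then (-1) ^ k * (Fintype.card Fˣ : ℤ) else - (-1) ^ k := by
  induction k generalizing v with
  | zero =>
    by_cases hv : v = 0
    · simp [hv, ← card_units_cast_add_one ℤ, add_comm]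
    · simp [hv]
  | succ k ih =>
    have h1 : (Finset.univ.filter fun y : Fin (k + 1) → Fˣ => v + ∑ i, (y i : F) = 0).card =
        ∑ a : Fˣ, (Finset.univ.filter fun y : Fin k → Fˣ =>
          (v + (a : F)) + ∑ i, (y i : F) = 0).card := by
      simp only [Finset.card_filter]
      rw [← (Fin.consEquiv fun _ => Fˣ).sum_comp, Fintype.sum_prod_type]
      refine Finset.sum_congr rfl fun a _ => Finset.sum_congr rfl fun y _ => ?_
      simp [Fin.consEquiv, Fin.sum_univ_succ, add_assoc]
    rw [h1]
    push_cast
    rw [Finset.mul_sum, Finset.sum_congr rfl fun (a : Fˣ) _ => ih (v + (a : F))]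
    rw [Finset.sum_add_distrib, Finset.sum_const, Finset.card_univ, nsmul_eq_mul]
    -- For `v = 0` no unit `a` satisfies `v + a = 0`; for `v ≠ 0` exactly one does, namely `-v`.
    by_cases hv : v = 0
    · subst hv
      simp
      ring
    · have h2 : (Finset.univ.filter fun a : Fˣ => v + (a : F) = 0) =
          {Units.mk0 (-v) (neg_ne_zero.2 hv)} := by
        ext a
        simp only [Finset.mem_filter, Finset.mem_univ, true_and, Finset.mem_singleton, Units.ext_iff,
          Units.val_mk0]
        constructor
        · intro h; linear_combination h
        · intro h; rw [h]; ring
      have h3 := Finset.card_filter_add_card_filter_not (s := (Finset.univ : Finset Fˣ))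
        fun a : Fˣ => v + (a : F) = 0
      rw [h2, Finset.card_singleton, Finset.card_univ] at h3
      rw [Finset.sum_ite, Finset.sum_const, Finset.sum_const, h2]
      simp only [Finset.card_singleton, nsmul_eq_mul, hv, if_false]
      have h4 : ((Finset.univ.filter fun a : Fˣ => ¬ v + (a : F) = 0).card : ℤ) =
          (Fintype.card Fˣ : ℤ) - 1 := by
        rw [← h3]; push_cast; ring
      rw [h4]
      push_cast
      ring

open Classical in
theorem card_add_sum_units_eq_zero {κ : Type*} [Fintype κ] [DecidableEq κ] (v : F) :
    ((Fintype.card F : ℤ)) * (Finset.univ.filter fun y : κ → Fˣ =>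
      v + ∑ i, (y i : F) = 0).card = (Fintype.card Fˣ : ℤ) ^ Fintype.card κ +
        if v = 0 then (-1) ^ Fintype.card κ * (Fintype.card Fˣ : ℤ)
          else - (-1) ^ Fintype.card κ := by
  rw [← card_add_sum_units_eq_zero_fin]
  congr 2
  let e := Fintype.equivFin κ
  refine Finset.card_equiv (Equiv.arrowCongr e (Equiv.refl Fˣ)) fun y => ?_
  simp only [Finset.mem_filter, Finset.mem_univ, true_and, Equiv.arrowCongr_apply,
    Equiv.coe_refl, Function.comp_apply, id_eq]
  rw [e.symm.sum_comp fun i => (y i : F)]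

open Classical in
/-- The number of zeros of `a + c²/a - 2 φ c`. -/
theorem card_conic_eq (hF : ringChar F ≠ 2) (φ : F) :
    ((Finset.univ.filter fun z : Fˣ × Fˣ =>
      (z.1 : F) + ((z.2 ^ 2 / z.1 : Fˣ) : F) - 2 * φ * z.2 = 0).card : ℤ) =
      Fintype.card Fˣ * (1 + quadraticChar F (φ ^ 2 - 1)) := by
  have h1 := quadraticChar_card_sqrts hF (φ ^ 2 - 1)
  have h2 : (Finset.univ.filter fun z : Fˣ × Fˣ =>
      (z.1 : F) + ((z.2 ^ 2 / z.1 : Fˣ) : F) - 2 * φ * z.2 = 0).card =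
      Fintype.card Fˣ * {x : F | x ^ 2 = φ ^ 2 - 1}.toFinset.card := by
    rw [← Finset.card_univ, ← Finset.card_product]
    -- Division by `c` gives `a / c + c / a = 2 φ`; completing the square with `x = a / c - φ` turns
    -- this into `x ^ 2 = φ ^ 2 - 1`.
    refine Finset.card_bij (fun z _ => (z.2, (z.1 : F) / z.2 - φ)) ?_ ?_ ?_
    · rintro ⟨a, c⟩ h
      simp only [Finset.mem_filter, Finset.mem_univ, true_and, Units.val_div_eq_div_val,
        Units.val_pow_eq_pow_val] at h
      simp only [Finset.mem_product, Finset.mem_univ, true_and, Set.mem_toFinset, Set.mem_ofPred_eq]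
      have ha := a.ne_zero
      have hc := c.ne_zero
      field_simp at h ⊢
      linear_combination h
    · rintro ⟨a, c⟩ - ⟨a', c'⟩ - h
      simp only [Prod.mk.injEq] at h
      obtain ⟨rfl, h⟩ := h
      have hc := c.ne_zero
      rw [sub_left_inj, div_left_inj' hc] at h
      rw [Units.ext h]
    · rintro ⟨c, x⟩ hx
      simp only [Finset.mem_product, Finset.mem_univ, true_and, Set.mem_toFinset,
        Set.mem_ofPred_eq] at hx
      have hc := c.ne_zero
      -- Needed for `a = (x + φ) c` to be a unit: `(x + φ) (x - φ) = -1`.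
      have hne : x + φ ≠ 0 := by
        intro h0
        have : (1 : F) = 0 := by linear_combination hx - (x - φ) * h0
        exact one_ne_zero this
      refine ⟨(Units.mk0 (x + φ) hne * c, c), ?_, ?_⟩
      · simp only [Finset.mem_filter, Finset.mem_univ, true_and, Units.val_div_eq_div_val,
          Units.val_pow_eq_pow_val, Units.val_mul, Units.val_mk0]
        field_simp
        linear_combination (c : F) * hx
      · simp [hc]
  rw [h2]
  push_cast
  rw [h1]
  ring

open Classical in
/-- The number of zeros of `a + c²/a - 2 φ c + ∑ yᵢ`. -/
theorem card_conic_add_sum (hF : ringChar F ≠ 2) (φ : F) {κ : Type*} [Fintype κ] [DecidableEq κ] :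
    (Fintype.card F : ℤ) * (Finset.univ.filter fun z : (Fˣ × Fˣ) × (κ → Fˣ) =>
      ((z.1.1 : F) + ((z.1.2 ^ 2 / z.1.1 : Fˣ) : F) - 2 * φ * z.1.2) +
        ∑ i, (z.2 i : F) = 0).card =
      (Fintype.card Fˣ : ℤ) ^ 2 * ((Fintype.card Fˣ : ℤ) ^ Fintype.card κ
        - (-1) ^ Fintype.card κ) + Fintype.card Fˣ * (1 + quadraticChar F (φ ^ 2 - 1)) *
        (-1) ^ Fintype.card κ * Fintype.card F := by
  have hc := card_conic_eq hF φ
  set g : Fˣ × Fˣ → F := fun z => (z.1 : F) + ((z.2 ^ 2 / z.1 : Fˣ) : F) - 2 * φ * z.2 with hg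
  have h1 : (Finset.univ.filter fun z : (Fˣ × Fˣ) × (κ → Fˣ) => g z.1 +
        ∑ i, (z.2 i : F) = 0).card = ∑ z : Fˣ × Fˣ, (Finset.univ.filter fun y : κ → Fˣ =>
          g z + ∑ i, (y i : F) = 0).card := by
    simp only [Finset.card_filter]
    rw [Fintype.sum_prod_type]
  rw [h1]
  push_cast
  rw [Finset.mul_sum, Finset.sum_congr rfl fun z _ => card_add_sum_units_eq_zero (g z),
    Finset.sum_add_distrib, Finset.sum_const, Finset.card_univ, nsmul_eq_mul, Fintype.card_prod,
    Finset.sum_ite, Finset.sum_const, Finset.sum_const]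
  have h3 := Finset.card_filter_add_card_filter_not (s := (Finset.univ : Finset (Fˣ × Fˣ)))
        fun z => g z = 0
  rw [Finset.card_univ, Fintype.card_prod] at h3
  have h4 : ((Finset.univ.filter fun z => ¬ g z = 0).card : ℤ) = (Fintype.card Fˣ : ℤ) ^ 2 -
      (Finset.univ.filter fun z => g z = 0).card := by
    rw [eq_sub_iff_add_eq, add_comm, sq]
    exact_mod_cast h3
  simp only [nsmul_eq_mul]
  rw [h4, ← card_units_cast_add_one (F := F)]
  change ((Finset.univ.filter fun z => g z = 0).card : ℤ) = _ at hc
  push_cast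
  linear_combination (-1) ^ Fintype.card κ * ((Fintype.card Fˣ : ℤ) + 1) * hc

end Units

/-! ### Monomials in the Cox variables -/

section CoxMonomials

variable {A : Type*} [CommGroup A]

theorem CoxVar.weight_eq (m : CoxVar) : m.1 0 + m.1 1 + 2 * (m.1 2 + m.1 3 + m.1 4) = 8 :=
  ((mem_coxMonomials m.1).1 m.2).1

/-- The monomial `x^{w_j}`. -/
def coordMonomial (j : Fin 5) : (CoxVar → A) →* A := monomialHom fun m => m.1 j

/-- The monomial `x^{w_φ}`. -/
def midMonomial : (CoxVar → A) →* A := monomialHom fun m => (m.1 0 + m.1 1) / 2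

/-- The monomial `x^{w_ψ}`. -/
def prodMonomial : (CoxVar → A) →* A := monomialHom fun _ => 1

/-- The weight equation makes `m 0 + m 1` even, so the halving is exact. This relation and
`midMonomial_mul` eliminate two coordinate monomials from the polynomial. -/
theorem coordMonomial_zero_mul_one (u : CoxVar → A) :
    coordMonomial 0 u * coordMonomial 1 u = midMonomial u ^ 2 := by
  simp only [coordMonomial, midMonomial, monomialHom_apply]
  rw [← Finset.prod_mul_distrib, ← Finset.prod_pow]
  refine Finset.prod_congr rfl fun m _ => ?_
  rw [← pow_add, ← pow_mul]
  congr 1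
  have := m.weight_eq
  omega

theorem midMonomial_mul (u : CoxVar → A) :
    midMonomial u * coordMonomial 2 u * coordMonomial 3 u * coordMonomial 4 u =
      prodMonomial u ^ 4 := by
  simp only [coordMonomial, midMonomial, prodMonomial, monomialHom_apply]
  rw [← Finset.prod_mul_distrib, ← Finset.prod_mul_distrib, ← Finset.prod_mul_distrib,
    ← Finset.prod_pow]
  refine Finset.prod_congr rfl fun m _ => ?_
  rw [← pow_add, ← pow_add, ← pow_add, ← pow_mul]
  congr 1
  have := m.weight_eq
  omega

/-- The Cox variable with the given exponents. -/
def coxVarMk (a b c d e : ℕ) (h : a + b + 2 * (c + d + e) = 8)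
    (h1 : ![a, b, c, d, e] ≠ 1) : CoxVar :=
  ⟨![a, b, c, d, e], (mem_coxMonomials _).2 ⟨by simpa using h, h1⟩⟩

/-- The lattice point next to the vertex at coordinate `k` in the direction of coordinate `j`. -/
def vertexEdge (j k : Fin 5) : Fin 5 → ℕ := fun i =>
  if i = j then 1 else if i = k then (if j < 2 then 7 else 6) else 0

theorem vertexEdge_mem : ∀ j k : Fin 5, k < 2 → j ≠ k →
    vertexEdge j k 0 + vertexEdge j k 1 +
      2 * (vertexEdge j k 2 + vertexEdge j k 3 + vertexEdge j k 4) = 8 ∧ vertexEdge j k ≠ 1 := by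
  decide

/-- The coordinate monomials outside a coordinate of weight one are independent. -/
theorem coordMonomial_surjective (J : Finset (Fin 5)) (k : Fin 5) (hk : k < 2) (hkJ : k ∉ J) :
    Function.Surjective (MonoidHom.pi fun j : J => (coordMonomial j.1 : (CoxVar → A) →* A)) := by
  intro y
  have hne : ∀ j : J, j.1 ≠ k := fun j h => hkJ (h ▸ j.2)
  -- The point `vertexEdge j k` has exponent one at `j` and is otherwise supported at `k ∉ J`, so
  -- its variable changes only one of the monomials indexed by `J`.
  refine ⟨∏ j : J, Pi.mulSingle ⟨vertexEdge j.1 k, (mem_coxMonomials _).2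
    (vertexEdge_mem j.1 k hk (hne j))⟩ (y j), ?_⟩
  ext i
  simp only [MonoidHom.pi_apply, map_prod, coordMonomial, monomialHom_mulSingle]
  rw [Finset.prod_eq_single i]
  · simp [vertexEdge]
  · intro j _ hj
    have h1 : i.1 ≠ j.1 := fun h => hj (Subtype.ext h.symm)
    simp [vertexEdge, h1, hne i]
  · simp

/-- The lattice point next to the vertex at `k` in the direction of `j`, both of weight two. -/
def innerEdge (j k : Fin 5) : Fin 5 → ℕ := fun i => if i = j then 1 else if i = k then 3 else 0

theorem innerEdge_mem : ∀ j k : Fin 5, 2 ≤ k → 2 ≤ j → j ≠ k →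
    innerEdge j k 0 + innerEdge j k 1 +
      2 * (innerEdge j k 2 + innerEdge j k 3 + innerEdge j k 4) = 8 ∧ innerEdge j k ≠ 1 := by
  decide

/-- Lattice points with coordinates `(a, 2 - a)` of weight one. -/
def outerEdge (k : Fin 5) (a : Fin 2) : Fin 5 → ℕ := fun i =>
  if i = 0 then a.1 else if i = 1 then 2 - a.1 else if i = k then 3 else 0

theorem outerEdge_mem : ∀ k : Fin 5, 2 ≤ k → ∀ a : Fin 2,
    outerEdge k a 0 + outerEdge k a 1 +
      2 * (outerEdge k a 2 + outerEdge k a 3 + outerEdge k a 4) = 8 ∧ outerEdge k a ≠ 1 := by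
  decide

/-- The monomials `x^{w₁}`, `x^{w_φ}` and the coordinate monomials of a proper subset of the
coordinates of weight two are independent. -/
theorem midMonomial_surjective (J : Finset (Fin 5)) (hJ : ∀ j ∈ J, 2 ≤ j) (k : Fin 5) (hk : 2 ≤ k)
    (hkJ : k ∉ J) :
    Function.Surjective (((coordMonomial 0 : (CoxVar → A) →* A).prod midMonomial).prod
      (MonoidHom.pi fun j : J => (coordMonomial j.1 : (CoxVar → A) →* A))) := by
  rintro ⟨⟨a, c⟩, y⟩
  have hne : ∀ j : J, j.1 ≠ k := fun j h => hkJ (h ▸ j.2)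
  have h0 : ∀ j : J, j.1 ≠ 0 := fun j h => absurd (hJ _ j.2) (by rw [h]; decide)
  have h1 : ∀ j : J, j.1 ≠ 1 := fun j h => absurd (hJ _ j.2) (by rw [h]; decide)
  have hk0 : k ≠ 0 := by rintro rfl; exact absurd hk (by decide)
  have hk1 : k ≠ 1 := by rintro rfl; exact absurd hk (by decide)
  -- The outer points have `(m 0, m 1)` equal to `(1, 1)` and `(0, 2)`. Both enter `midMonomial`
  -- once and only the first enters `coordMonomial 0`; hence the values `a` and `c / a`.
  refine ⟨Pi.mulSingle ⟨outerEdge k 1, (mem_coxMonomials _).2 (outerEdge_mem k hk 1)⟩ a *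
    Pi.mulSingle ⟨outerEdge k 0, (mem_coxMonomials _).2 (outerEdge_mem k hk 0)⟩ (c / a) *
    ∏ j : J, Pi.mulSingle ⟨innerEdge j.1 k, (mem_coxMonomials _).2
      (innerEdge_mem j.1 k hk (hJ _ j.2) (hne j))⟩ (y j), ?_⟩
  rw [MonoidHom.prod_apply, MonoidHom.prod_apply]
  simp only [map_mul, map_prod, coordMonomial, midMonomial]
  refine Prod.ext (Prod.ext ?_ ?_) ?_
  · simp [monomialHom_mulSingle, outerEdge, innerEdge, (h0 _).symm, hk0.symm]
  · simp [monomialHom_mulSingle, outerEdge, innerEdge, (h0 _).symm, hk0.symm, (h1 _).symm, hk1.symm]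
  · ext i
    simp only [MonoidHom.pi_apply, monomialHom_mulSingle, Pi.mul_apply, Finset.prod_apply]
    rw [Finset.prod_eq_single i]
    · simp [outerEdge, innerEdge, h0 i, h1 i, hne i]
    · intro j _ hj
      have h1 : i.1 ≠ j.1 := fun h => hj (Subtype.ext h.symm)
      simp [innerEdge, h1, hne i]
    · simp

/-- Independent monomials generating the characters of the torus of Cox coordinates that are
needed for the mirror polynomial. -/
def torusHom : (CoxVar → A) →* (Fin 5 → A) :=
  MonoidHom.pi fun i => match i with
    | 0 => coordMonomial 0
    | 1 => midMonomial
    | 2 => coordMonomial 2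
    | 3 => coordMonomial 3
    | 4 => prodMonomial

theorem torusHom_surjective : Function.Surjective (torusHom : (CoxVar → A) →* (Fin 5 → A)) := by
  intro y
  -- The exponents of the five target monomials in these variables form a unitriangular system. The
  -- vertex `(0,0,0,0,4)` enters only `prodMonomial` and corrects it last.
  refine ⟨Pi.mulSingle (coxVarMk 1 1 0 0 3 rfl (by decide)) (y 0) *
    Pi.mulSingle (coxVarMk 0 2 0 0 3 rfl (by decide)) (y 1 / y 0) *
    Pi.mulSingle (coxVarMk 0 0 1 0 3 rfl (by decide)) (y 2) *
    Pi.mulSingle (coxVarMk 0 0 0 1 3 rfl (by decide)) (y 3) *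
    Pi.mulSingle (coxVarMk 0 0 0 0 4 rfl (by decide)) (y 4 / (y 1 * y 2 * y 3)), ?_⟩
  ext i
  simp only [torusHom, MonoidHom.pi_apply, map_mul]
  fin_cases i <;>
    simp [coordMonomial, midMonomial, prodMonomial, monomialHom_mulSingle, coxVarMk, mul_assoc]

end CoxMonomials

/-! ### Zeros of the polynomial on strata and the order of the Cox group -/

section FaceCount

variable {F : Type*} [Field F]

open Classical in
/-- The part of the mirror polynomial that does not vanish identically where exactly the
coordinates in the interior of a simplex with zero coordinates `J` vanish. -/
def facePoly (J : Finset (Fin 5)) (φ : F) (u : CoxVar → Fˣ) : F :=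
  ∑ j ∈ J, ((coordMonomial j u : Fˣ) : F) - if 0 ∈ J ∧ 1 ∈ J then 2 * φ * (midMonomial u : Fˣ) else 0

/-- The mirror polynomial in terms of independent monomials. -/
def torusPoly (φ ψ : F) (z : Fin 5 → Fˣ) : F :=
  (z 0 : F) + ((z 1 ^ 2 / z 0 : Fˣ) : F) + z 2 + z 3 + ((z 4 ^ 4 / (z 1 * z 2 * z 3) : Fˣ) : F) -
    2 * φ * z 1 - 8 * ψ * z 4

theorem mirrorPoly_units (φ ψ : F) (u : CoxVar → Fˣ) :
    mirrorPoly φ ψ (fun m => (u m : F)) = torusPoly φ ψ (torusHom u) := by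
  have h0 : torusHom u 0 = coordMonomial 0 u := rfl
  have h1 : torusHom u 1 = midMonomial u := rfl
  have h2 : torusHom u 2 = coordMonomial 2 u := rfl
  have h3 : torusHom u 3 = coordMonomial 3 u := rfl
  have h4 : torusHom u 4 = prodMonomial u := rfl
  rw [torusPoly, h0, h1, h2, h3, h4, ← midMonomial_mul, ← coordMonomial_zero_mul_one,
    mul_div_cancel_left, mul_div_cancel_left]
  simp [mirrorPoly, Fin.sum_univ_five, coordMonomial, midMonomial, prodMonomial, monomialHom_apply]

theorem torusPoly_mul (φ ψ : F) (a : Fˣ) (z : Fin 5 → Fˣ) :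
    torusPoly φ ψ ((fun _ => a) * z) = a * torusPoly φ ψ z := by
  have h1 : (a * z 1) ^ 2 / (a * z 0) = a * (z 1 ^ 2 / z 0) := by
    rw [mul_pow, sq a, mul_assoc, mul_div_mul_left_eq_div, mul_div_assoc]
  have h2 : (a * z 4) ^ 4 / (a * z 1 * (a * z 2) * (a * z 3)) =
      a * (z 4 ^ 4 / (z 1 * z 2 * z 3)) := by
    refine Units.ext ?_
    simp only [Units.val_div_eq_div_val, Units.val_mul, Units.val_pow_eq_pow_val]
    field_simp
  simp only [torusPoly, Pi.mul_apply, h1, h2, Units.val_mul]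
  ring

theorem mem_coxGroup_iff (g : CoxVar → Fˣ) :
    g ∈ coxGroup F ↔ ∀ j, coordMonomial j g = prodMonomial g := by
  change (∀ j : Fin 5, ∏ m, g m ^ ((m.1 j : ℤ) - 1) = 1) ↔ _
  refine forall_congr' fun j => ?_
  rw [← div_eq_one (a := coordMonomial j g)]
  simp [coordMonomial, prodMonomial, monomialHom_apply, zpow_sub, Finset.prod_mul_distrib,
    div_eq_mul_inv]

/-- Cancel the cube of `prodMonomial g` in `midMonomial_mul`. -/
theorem midMonomial_of_mem_coxGroup {g : CoxVar → Fˣ} (hg : g ∈ coxGroup F) :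
    midMonomial g = prodMonomial g := by
  have h := midMonomial_mul g
  rw [mem_coxGroup_iff] at hg
  rw [hg, hg, hg, mul_assoc, mul_assoc, show prodMonomial g ^ 4 = prodMonomial g *
    (prodMonomial g * (prodMonomial g * prodMonomial g)) by simp [pow_succ, mul_assoc]] at h
  exact mul_right_cancel h

/-- The Cox group is the preimage of the diagonal under the surjection `torusHom`; this gives its
order in `card_coxGroup`. -/
theorem mem_coxGroup_iff_torusHom (g : CoxVar → Fˣ) :
    g ∈ coxGroup F ↔ ∃ a, torusHom g = fun _ => a := by
  constructor
  · intro hg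
    refine ⟨prodMonomial g, ?_⟩
    have h := midMonomial_of_mem_coxGroup hg
    rw [mem_coxGroup_iff] at hg
    funext i
    fin_cases i
    exacts [hg 0, h, hg 2, hg 3, rfl]
  · rintro ⟨a, ha⟩
    have h0 : coordMonomial 0 g = a := congrFun ha 0
    have h1 : midMonomial g = a := congrFun ha 1
    have h2 : coordMonomial 2 g = a := congrFun ha 2
    have h3 : coordMonomial 3 g = a := congrFun ha 3
    have h4 : prodMonomial g = a := congrFun ha 4
    have e1 := coordMonomial_zero_mul_one g
    have e2 := midMonomial_mul g
    rw [h0, h1, sq] at e1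
    rw [h1, h2, h3, h4, show a ^ 4 = a * a * a * a by simp [pow_succ, mul_assoc]] at e2
    rw [mem_coxGroup_iff, h4]
    intro j
    fin_cases j
    exacts [h0, mul_left_cancel e1, h2, h3, mul_left_cancel e2]

variable [Fintype F]

open Classical in
/-- The number of zeros of `facePoly` in units. -/
def faceCount (J : Finset (Fin 5)) (φ : F) : ℕ :=
  (Finset.univ.filter fun u : CoxVar → Fˣ => facePoly J φ u = 0).card

open Classical in
-- A coordinate of weight one is missing from `J`, so the monomials in `facePoly` take independent
-- unit values, and the count is that of vanishing sums of `J.card` units times the size of a fibre.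
theorem faceCount_of_notMem (J : Finset (Fin 5)) (φ : F) (hJ : ¬ (0 ∈ J ∧ 1 ∈ J)) :
    (Fintype.card F : ℤ) * (faceCount J φ * (Fintype.card Fˣ : ℤ) ^ J.card) =
      ((Fintype.card Fˣ : ℤ) ^ J.card + (-1) ^ J.card * Fintype.card Fˣ) *
        Fintype.card (CoxVar → Fˣ) := by
  obtain ⟨k, hk, hkJ⟩ : ∃ k : Fin 5, k < 2 ∧ k ∉ J := by
    by_cases h : 0 ∈ J
    · exact ⟨1, by decide, fun h' => hJ ⟨h, h'⟩⟩
    · exact ⟨0, by decide, h⟩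
  have h1 := card_filter_hom_mul_card _ (coordMonomial_surjective (A := Fˣ) J k hk hkJ)
    fun y => 0 + ∑ j, (y j : F) = 0
  have h2 := card_add_sum_units_eq_zero (κ := J) (0 : F)
  rw [if_pos rfl, Fintype.card_coe] at h2
  rw [← h2, mul_assoc]
  congr 1
  rw [Fintype.card_fun, Fintype.card_coe] at h1
  rw [← Nat.cast_pow, ← Nat.cast_mul, ← Nat.cast_mul, ← h1]
  congr 3
  unfold faceCount
  congr 1
  ext u
  simp only [facePoly, if_neg hJ, zero_add, sub_zero, MonoidHom.pi_apply,
    Finset.mem_filter, Finset.mem_univ, true_and]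
  rw [Finset.sum_coe_sort J fun j => ((coordMonomial j u : Fˣ) : F)]

open Classical in
-- With `a = coordMonomial 0 u` and `c = midMonomial u`, the second coordinate monomial is `c ^ 2 /
-- a`. A coordinate of weight two outside `J` makes `a`, `c` and the other monomials independent,
-- which leaves the conic plus a sum of `s` free units.
theorem faceCount_of_mem (hF : ringChar F ≠ 2) (J : Finset (Fin 5)) (φ : F) (h0 : 0 ∈ J)
    (h1 : 1 ∈ J) (hJ : J ≠ Finset.univ) (s : ℕ) (hs : J.card = s + 2) :
    (Fintype.card F : ℤ) * (faceCount J φ * (Fintype.card Fˣ : ℤ) ^ J.card) =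
      ((Fintype.card Fˣ : ℤ) ^ 2 * ((Fintype.card Fˣ : ℤ) ^ s - (-1) ^ s) +
        Fintype.card Fˣ * (1 + quadraticChar F (φ ^ 2 - 1)) * (-1) ^ s * Fintype.card F) *
        Fintype.card (CoxVar → Fˣ) := by
  obtain ⟨k, hk, hkJ⟩ : ∃ k : Fin 5, 2 ≤ k ∧ k ∉ J := by
    by_contra! h
    exact hJ (Finset.eq_univ_iff_forall.2 fun i => by
      fin_cases i
      exacts [h0, h1, h 2 (by decide), h 3 (by decide), h 4 (by decide)])
  have hJ' : J = insert 0 (insert 1 (J.filter fun j => 2 ≤ j)) := by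
    ext i
    fin_cases i <;> simp [h0, h1]
  have hn0 : (0 : Fin 5) ∉ insert 1 (J.filter fun j => 2 ≤ j) := by simp
  have hn1 : (1 : Fin 5) ∉ J.filter fun j => 2 ≤ j := by simp
  have hcard : (J.filter fun j => 2 ≤ j).card = s := by
    rw [hJ', Finset.card_insert_of_notMem hn0, Finset.card_insert_of_notMem hn1] at hs
    omega
  have e1 := card_filter_hom_mul_card _ (midMonomial_surjective (A := Fˣ)
    (J.filter fun j => 2 ≤ j) (fun j hj => (Finset.mem_filter.1 hj).2) k hk
    fun h => hkJ (Finset.mem_filter.1 h).1)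
    fun z => ((z.1.1 : F) + ((z.1.2 ^ 2 / z.1.1 : Fˣ) : F) - 2 * φ * z.1.2) +
        ∑ i, (z.2 i : F) = 0
  have e2 := card_conic_add_sum hF φ (κ := (J.filter fun j => 2 ≤ j : Finset (Fin 5)))
  rw [Fintype.card_coe, hcard] at e2
  rw [← e2, mul_assoc]
  congr 1
  rw [Fintype.card_prod, Fintype.card_prod, Fintype.card_fun, Fintype.card_coe, hcard] at e1
  rw [← Nat.cast_mul, ← e1, hs, Nat.cast_mul, Nat.cast_mul, Nat.cast_mul, Nat.cast_pow]
  have e3 : faceCount J φ = (Finset.univ.filter fun u : CoxVar → Fˣ =>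
      (((coordMonomial 0 u : Fˣ) : F) + ((midMonomial u ^ 2 / coordMonomial 0 u : Fˣ) : F) -
        2 * φ * (midMonomial u : Fˣ)) + ∑ i : (J.filter fun j => 2 ≤ j : Finset (Fin 5)),
          ((coordMonomial i.1 u : Fˣ) : F) = 0).card := by
    unfold faceCount
    congr 1
    ext u
    simp only [Finset.mem_filter, Finset.mem_univ, true_and]
    rw [Finset.sum_coe_sort (J.filter fun j => 2 ≤ j) fun j => ((coordMonomial j u : Fˣ) : F),
      facePoly, if_pos ⟨h0, h1⟩, ← coordMonomial_zero_mul_one, mul_div_cancel_left]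
    conv_lhs => rw [hJ', Finset.sum_insert hn0, Finset.sum_insert hn1]
    constructor <;> intro h <;> linear_combination h
  rw [e3]
  simp only [MonoidHom.prod_apply, MonoidHom.pi_apply]
  rw [show (Fintype.card Fˣ : ℤ) ^ (s + 2) =
    Fintype.card Fˣ * Fintype.card Fˣ * (Fintype.card Fˣ : ℤ) ^ s by ring]

open Classical in
theorem card_mirrorPoly_units (φ ψ : F) :
    (Finset.univ.filter fun u : CoxVar → Fˣ => mirrorPoly φ ψ (fun m => (u m : F)) = 0).card *
      Fintype.card Fˣ ^ 5 =
    (Finset.univ.filter fun z : Fin 5 → Fˣ => torusPoly φ ψ z = 0).card *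
      Fintype.card (CoxVar → Fˣ) := by
  have h := card_filter_hom_mul_card _ (torusHom_surjective (A := Fˣ))
    fun z => torusPoly φ ψ z = 0
  rw [Fintype.card_fun, Fintype.card_fin] at h
  simpa only [mirrorPoly_units] using h

open Classical in
theorem card_coxGroup : Nat.card (coxGroup F) * Fintype.card Fˣ ^ 4 = Fintype.card (CoxVar → Fˣ) := by
  have h := card_filter_hom_mul_card _ (torusHom_surjective (A := Fˣ)) fun z => ∃ a, z = fun _ => a
  have h1 : (Finset.univ.filter fun z : Fin 5 → Fˣ => ∃ a, z = fun _ => a).card =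
      Fintype.card Fˣ := by
    rw [← Finset.card_univ, ← Finset.card_image_of_injective Finset.univ
      (f := fun (a : Fˣ) (_ : Fin 5) => a) fun a b hab => congrFun hab 0]
    congr 1
    ext z
    simp [eq_comm]
  rw [h1, Fintype.card_fun, Fintype.card_fin] at h
  have h2 : Nat.card (coxGroup F) = (Finset.univ.filter fun u : CoxVar → Fˣ =>
      ∃ a, torusHom u = fun _ => a).card := by
    rw [Nat.card_eq_fintype_card, Fintype.card_subtype]
    congr 1
    ext g
    simp only [Finset.mem_filter, Finset.mem_univ, true_and]
    exact mem_coxGroup_iff_torusHom g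
  rw [h2]
  refine Nat.eq_of_mul_eq_mul_left (Fintype.card_pos (α := Fˣ)) ?_
  linarith

end FaceCount

/-! ### Evaluation of the Gauss sums -/

section GaussEval

variable {F : Type*} [Field F] [Fintype F] {𝕂 : Type*} [Field 𝕂]

open Classical in
theorem gauss_eq_sum (Θ : AddChar F 𝕂) (ω : Fˣ →* 𝕂ˣ) (c : F) (n : ℤ) :
    gauss Θ ω c n = ∑ x : Fˣ, Θ (c * x) * (ω x : 𝕂) ^ n := by
  unfold gauss
  simp only [Units.val_zpow_eq_zpow_val]
  congr!

open Classical in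
theorem sum_range_character (ω : Fˣ →* 𝕂ˣ) (hω : Function.Injective ω) (x : Fˣ) :
    ∑ t ∈ Finset.range (Fintype.card F - 1), (ω x : 𝕂) ^ t =
      if x = 1 then (Fintype.card Fˣ : 𝕂) else 0 := by
  rw [← Fintype.card_units]
  split_ifs with h
  · simp [h]
  · have h1 : (ω x : 𝕂) ≠ 1 := fun h' => h (hω (by rw [map_one]; exact Units.ext h'))
    rw [geom_sum_eq h1, ← Units.val_pow_eq_pow_val, ← map_pow, pow_card_eq_one, map_one]
    simp

open Classical in
theorem sum_range_sum_character {X : Type*} [Fintype X] (ω : Fˣ →* 𝕂ˣ)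
    (hω : Function.Injective ω) (f : X → 𝕂) (e : X → Fˣ) :
    ∑ t ∈ Finset.range (Fintype.card F - 1), ∑ x, f x * (ω (e x) : 𝕂) ^ t =
      Fintype.card Fˣ * ∑ x, if e x = 1 then f x else 0 := by
  rw [Finset.sum_comm, Finset.mul_sum]
  refine Finset.sum_congr rfl fun x _ => ?_
  rw [← Finset.mul_sum, sum_range_character ω hω]
  split_ifs <;> ring

open Classical in
theorem sum_units_mul_addChar (Θ : AddChar F 𝕂) (hΘ : Θ ≠ 1) (v : F) :
    ∑ x : Fˣ, Θ (x * v) = if v = 0 then (Fintype.card Fˣ : 𝕂) else -1 := by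
  split_ifs with hv
  · simp [hv]
  · have h := AddChar.sum_eq_zero_of_ne_one hΘ
    have h1 : ∑ x : F, Θ x = ∑ x : F, Θ (x * v) :=
      (Fintype.sum_equiv (Equiv.mulRight₀ v hv) _ _ fun x => rfl).symm
    have h2 : ∑ x : Fˣ, Θ (x * v) = ∑ x ∈ (Finset.univ : Finset F).erase 0, Θ (x * v) := by
      refine Finset.sum_bij (fun x _ => (x : F)) (by simp) (fun a _ b _ h => Units.ext h) ?_
        (fun _ _ => rfl)
      intro b hb
      exact ⟨Units.mk0 b (Finset.ne_of_mem_erase hb), by simp, by simp⟩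
    rw [h1, ← Finset.add_sum_erase _ _ (Finset.mem_univ 0), zero_mul,
      AddChar.map_zero_eq_one] at h
    rw [h2]
    linear_combination h

open Classical in
/-- The exponential sum of a homogeneous function in terms of the number of its zeros. -/
theorem card_mul_sum_addChar {X : Type*} [Group X] [Fintype X] (Θ : AddChar F 𝕂) (hΘ : Θ ≠ 1)
    (P : X → F) (s : Fˣ → X) (hP : ∀ a x, P (s a * x) = a * P x) :
    (Fintype.card Fˣ : 𝕂) * ∑ x, Θ (P x) =
      Fintype.card F * (Finset.univ.filter fun x => P x = 0).card - Fintype.card X := by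
  -- Translation by `s a` does not change the sum; averaging over `a` makes the character sum detect
  -- `P x = 0`.
  have h1 : (Fintype.card Fˣ : 𝕂) * ∑ x, Θ (P x) = ∑ a : Fˣ, ∑ x, Θ (a * P x) := by
    rw [← nsmul_eq_mul, ← Finset.card_univ, ← Finset.sum_const]
    refine Finset.sum_congr rfl fun a _ => ?_
    rw [← Equiv.sum_comp (Equiv.mulLeft (s a))]
    simp [hP]
  rw [h1, Finset.sum_comm, Finset.sum_congr rfl fun x _ => sum_units_mul_addChar Θ hΘ (P x),
    Finset.sum_ite, Finset.sum_const, Finset.sum_const]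
  have h2 := Finset.card_filter_add_card_filter_not (s := (Finset.univ : Finset X))
    fun x => P x = 0
  rw [Finset.card_univ] at h2
  rw [← h2, ← card_units_cast_add_one (F := F)]
  simp only [nsmul_eq_mul]
  push_cast
  ring

theorem sum_mul_sum_mul_sum {α β γ : Type*} [Fintype α] [Fintype β] [Fintype γ] (f : α → 𝕂)
    (g : β → 𝕂) (h : γ → 𝕂) :
    (∑ a, f a) * (∑ b, g b) * ∑ c, h c = ∑ x : (α × β) × γ, f x.1.1 * g x.1.2 * h x.2 := by
  rw [Fintype.sum_mul_sum, Fintype.sum_prod_type, Fintype.sum_prod_type, Finset.sum_mul]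
  refine Finset.sum_congr rfl fun a _ => ?_
  rw [Finset.sum_mul]
  exact Finset.sum_congr rfl fun b _ => Finset.mul_sum _ _ _

open Classical in
-- With `a`, `b` the variables of the squared Gauss sum and `c` that of the other, summation over
-- `u` imposes `c ^ 2 = a b`, so `b = c ^ 2 / a` is eliminated.
theorem sum_gauss_conic (Θ : AddChar F 𝕂) (ω : Fˣ →* 𝕂ˣ) (hω : Function.Injective ω) (κ : F)
    (t : ℤ) :
    ∑ u ∈ Finset.range (Fintype.card F - 1), gauss Θ ω 1 (-u) ^ 2 * gauss Θ ω κ (2 * u - t) =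
      Fintype.card Fˣ * ∑ z : Fˣ × Fˣ,
        Θ ((z.1 : F) + ((z.2 ^ 2 / z.1 : Fˣ) : F) + κ * z.2) * (ω z.2 : 𝕂) ^ (-t) := by
  have h1 : ∀ u : ℕ, gauss Θ ω 1 (-u) ^ 2 * gauss Θ ω κ (2 * u - t) =
      ∑ x : (Fˣ × Fˣ) × Fˣ, (Θ (x.1.1 + x.1.2 + κ * x.2) * (ω x.2 : 𝕂) ^ (-t)) *
        (ω (x.2 ^ 2 / (x.1.1 * x.1.2)) : 𝕂) ^ u := by
    intro u
    rw [sq, gauss_eq_sum, gauss_eq_sum, sum_mul_sum_mul_sum]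
    refine Finset.sum_congr rfl fun x _ => ?_
    have e : (ω (x.2 ^ 2 / (x.1.1 * x.1.2)) : 𝕂) ^ u =
        (ω x.1.1 : 𝕂) ^ (-(u : ℤ)) * (ω x.1.2 : 𝕂) ^ (-(u : ℤ)) * (ω x.2 : 𝕂) ^ (2 * (u : ℤ)) := by
      rw [zpow_neg, zpow_neg, zpow_mul, zpow_natCast, zpow_natCast, zpow_natCast]
      simp [mul_pow, div_eq_mul_inv]
      ring
    rw [e, AddChar.map_add_eq_mul, AddChar.map_add_eq_mul, one_mul, one_mul,
      sub_eq_add_neg, zpow_add₀ (ω x.2).ne_zero]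
    ring
  rw [Finset.sum_congr rfl fun u _ => h1 u, sum_range_sum_character ω hω,
    Fintype.sum_prod_type, Fintype.sum_prod_type, Fintype.sum_prod_type]
  congr 1
  refine Finset.sum_congr rfl fun a _ => ?_
  rw [Finset.sum_comm]
  refine Finset.sum_congr rfl fun c _ => ?_
  rw [Finset.sum_eq_single (c ^ 2 / a)]
  · rw [if_pos (by simp)]
  · intro b _ hb
    rw [if_neg]
    intro h
    rw [div_eq_one] at h
    exact hb (by rw [h]; simp)
  · simp

open Classical in
-- The sum over `u` imposes the conic relation; the sum over `t` then imposes `d ^ 4 = c b₁ b₂ b₃`.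
-- These are the two relations between the monomials of the mirror polynomial.
theorem sum_gauss_torus (Θ : AddChar F 𝕂) (ω : Fˣ →* 𝕂ˣ) (hω : Function.Injective ω) (φ ψ : F) :
    ∑ t ∈ Finset.range (Fintype.card F - 1), ∑ u ∈ Finset.range (Fintype.card F - 1),
        gauss Θ ω 1 (-u) ^ 2 * gauss Θ ω 1 (-t) ^ 3 *
          gauss Θ ω (-2 * φ) (2 * u - t) * gauss Θ ω (-8 * ψ) (4 * t) =
      (Fintype.card Fˣ : 𝕂) ^ 2 * ∑ z : Fin 5 → Fˣ, Θ (torusPoly φ ψ z) := by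
  have h1 : ∀ t : ℕ, ∑ u ∈ Finset.range (Fintype.card F - 1),
        gauss Θ ω 1 (-u) ^ 2 * gauss Θ ω 1 (-t) ^ 3 *
          gauss Θ ω (-2 * φ) (2 * u - t) * gauss Θ ω (-8 * ψ) (4 * t) =
      Fintype.card Fˣ * ∑ x : (((Fˣ × Fˣ) × Fˣ) × (Fˣ × Fˣ)) × Fˣ,
        Θ ((x.1.2.1 : F) + ((x.1.2.2 ^ 2 / x.1.2.1 : Fˣ) : F) + x.1.1.1.1 + x.1.1.1.2 + x.1.1.2 -
          2 * φ * x.1.2.2 - 8 * ψ * x.2) *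
          (ω (x.2 ^ 4 / (x.1.2.2 * x.1.1.1.1 * x.1.1.1.2 * x.1.1.2)) : 𝕂) ^ t := by
    intro t
    have h2 : ∀ u ∈ Finset.range (Fintype.card F - 1),
        gauss Θ ω 1 (-u) ^ 2 * gauss Θ ω 1 (-t) ^ 3 *
          gauss Θ ω (-2 * φ) (2 * u - t) * gauss Θ ω (-8 * ψ) (4 * t) =
        gauss Θ ω 1 (-u) ^ 2 * gauss Θ ω (-2 * φ) (2 * u - t) *
          (gauss Θ ω 1 (-t) ^ 3 * gauss Θ ω (-8 * ψ) (4 * t)) := fun u _ => by ring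
    rw [Finset.sum_congr rfl h2, ← Finset.sum_mul, sum_gauss_conic Θ ω hω, mul_assoc]
    congr 1
    have h3 : ∀ a b c : 𝕂, a * (b ^ 3 * c) = b * b * b * a * c := fun a b c => by ring
    rw [h3, gauss_eq_sum, gauss_eq_sum, sum_mul_sum_mul_sum, sum_mul_sum_mul_sum]
    refine Finset.sum_congr rfl fun x _ => ?_
    have e : (ω (x.2 ^ 4 / (x.1.2.2 * x.1.1.1.1 * x.1.1.1.2 * x.1.1.2)) : 𝕂) ^ t =
        (ω x.1.2.2 : 𝕂) ^ (-(t : ℤ)) * (ω x.1.1.1.1 : 𝕂) ^ (-(t : ℤ)) *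
          (ω x.1.1.1.2 : 𝕂) ^ (-(t : ℤ)) * (ω x.1.1.2 : 𝕂) ^ (-(t : ℤ)) *
          (ω x.2 : 𝕂) ^ (4 * (t : ℤ)) := by
      rw [zpow_neg, zpow_neg, zpow_neg, zpow_neg, zpow_mul, zpow_natCast, zpow_natCast,
        zpow_natCast, zpow_natCast, zpow_natCast]
      simp [mul_pow, div_eq_mul_inv]
      ring
    have e2 : (x.1.2.1 : F) + ((x.1.2.2 ^ 2 / x.1.2.1 : Fˣ) : F) + x.1.1.1.1 + x.1.1.1.2 +
        x.1.1.2 - 2 * φ * x.1.2.2 - 8 * ψ * x.2 =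
        1 * x.1.1.1.1 + 1 * x.1.1.1.2 + 1 * x.1.1.2 + (x.1.2.1 +
          ((x.1.2.2 ^ 2 / x.1.2.1 : Fˣ) : F) + -2 * φ * x.1.2.2) + -8 * ψ * x.2 := by ring
    rw [e, e2]
    simp only [AddChar.map_add_eq_mul]
    ring
  rw [Finset.sum_congr rfl fun t _ => h1 t, ← Finset.mul_sum, sum_range_sum_character ω hω,
    sq, mul_assoc]
  congr 2
  rw [← Finset.sum_filter]
  refine Finset.sum_nbij' (fun x => ![x.1.2.1, x.1.2.2, x.1.1.1.1, x.1.1.1.2, x.2])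
    (fun z => ((((z 2, z 3), z 4 ^ 4 / (z 1 * z 2 * z 3)), (z 0, z 1)), z 4))
    (by simp) (by simp) ?_ ?_ ?_
  · rintro ⟨⟨⟨⟨b₁, b₂⟩, b₃⟩, a, c⟩, d⟩ h
    simp only [Finset.mem_filter, Finset.mem_univ, true_and, div_eq_one] at h
    simp [h]
  · intro z _
    ext i
    fin_cases i <;> rfl
  · rintro ⟨⟨⟨⟨b₁, b₂⟩, b₃⟩, a, c⟩, d⟩ h
    simp only [Finset.mem_filter, Finset.mem_univ, true_and, div_eq_one] at h
    have h' : d ^ 4 / (c * b₁ * b₂) = b₃ := by rw [h]; simp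
    change _ = Θ ((a : F) + ((c ^ 2 / a : Fˣ) : F) + b₁ + b₂ +
      ((d ^ 4 / (c * b₁ * b₂) : Fˣ) : F) - 2 * φ * c - 8 * ψ * d)
    rw [h']

open Classical in
/-- The contribution of the class `(0,0,0,0,0)` in terms of the points of the torus. -/
theorem N0_eq [CharZero 𝕂] (hF : ringChar F ≠ 2) (Θ : AddChar F 𝕂) (hΘ : Θ ≠ 1) (ω : Fˣ →* 𝕂ˣ)
    (hω : Function.Injective ω) (φ ψ : F) :
    N0 Θ ω φ ψ =
      ((Finset.univ.filter fun z : Fin 5 → Fˣ => torusPoly φ ψ z = 0).card : 𝕂) /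
        Fintype.card Fˣ - (Fintype.card Fˣ : 𝕂) ^ 4 / Fintype.card F +
        (1 + (quadraticChar F (φ ^ 2 - 1) : ℤ)) - (Fintype.card Fˣ : 𝕂) / Fintype.card F := by
  have hq : (Fintype.card F : 𝕂) ≠ 0 := Nat.cast_ne_zero.2 Fintype.card_ne_zero
  have hQ : (Fintype.card Fˣ : 𝕂) ≠ 0 := Nat.cast_ne_zero.2 Fintype.card_ne_zero
  have hqQ : (Fintype.card F : 𝕂) - 1 = Fintype.card Fˣ := by
    rw [← card_units_cast_add_one]; ring
  have h1 := card_mul_sum_addChar Θ hΘ (torusPoly φ ψ) (fun a _ => a) (torusPoly_mul φ ψ)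
  have h2 := card_mul_sum_addChar Θ hΘ (fun z : Fˣ × Fˣ =>
    (z.1 : F) + ((z.2 ^ 2 / z.1 : Fˣ) : F) + -2 * φ * z.2) (fun a => (a, a)) (by
      rintro a ⟨b, c⟩
      have h1 : (a * c) ^ 2 / (a * b) = a * (c ^ 2 / b) := by
        rw [mul_pow, sq a, mul_assoc, mul_div_mul_left_eq_div, mul_div_assoc]
      simp only [Prod.mk_mul_mk, h1, Units.val_mul]
      ring)
  have h3 := sum_gauss_conic Θ ω hω (-2 * φ) 0
  simp only [sub_zero, neg_zero, zpow_zero, mul_one] at h3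
  have h4 := congrArg (Int.cast : ℤ → 𝕂) (card_conic_eq hF φ)
  have h5 : (Finset.univ.filter fun z : Fˣ × Fˣ =>
      (z.1 : F) + ((z.2 ^ 2 / z.1 : Fˣ) : F) + -2 * φ * z.2 = 0) =
      Finset.univ.filter fun z : Fˣ × Fˣ =>
      (z.1 : F) + ((z.2 ^ 2 / z.1 : Fˣ) : F) - 2 * φ * z.2 = 0 := by
    ext z
    simp only [Finset.mem_filter, Finset.mem_univ, true_and]
    constructor <;> intro h <;> linear_combination h
  rw [h5] at h2
  rw [Int.cast_natCast, Int.cast_mul, Int.cast_natCast, Int.cast_add, Int.cast_one] at h4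
  rw [h4] at h2
  rw [Fintype.card_prod, Nat.cast_mul] at h2
  rw [Fintype.card_fun, Fintype.card_fin, Nat.cast_pow] at h1
  simp only [N0]
  rw [sum_gauss_torus Θ ω hω, h3, hqQ]
  have h1' := eq_div_of_mul_eq hQ ((mul_comm _ _).trans h1)
  have h2' := eq_div_of_mul_eq hQ ((mul_comm _ _).trans h2)
  rw [h1', h2']
  field_simp
  ring

end GaussEval

/-! ### Fine triangulations of the boundary of the Newton polyhedron -/

section Triangulation

theorem CoxVar.toPoint_injective : Function.Injective CoxVar.toPoint := by
  intro a b h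
  refine Subtype.ext (funext fun i => ?_)
  have := congrFun h i
  exact Nat.cast_injective (R := ℝ) this

theorem CoxVar.toPoint_weight (m : CoxVar) :
    m.toPoint 0 + m.toPoint 1 + 2 * (m.toPoint 2 + m.toPoint 3 + m.toPoint 4) = 8 := by
  have := m.weight_eq
  simp only [CoxVar.toPoint]
  exact_mod_cast this

/-- The weighted degree of a point. -/
def weight : (Fin 5 → ℝ) →ₗ[ℝ] ℝ where
  toFun v := v 0 + v 1 + 2 * (v 2 + v 3 + v 4)
  map_add' u v := by simp; ring
  map_smul' c v := by simp; ring

theorem weight_apply (v : Fin 5 → ℝ) : weight v = v 0 + v 1 + 2 * (v 2 + v 3 + v 4) := rfl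

theorem weight_toPoint (m : CoxVar) : weight m.toPoint = 8 := m.toPoint_weight

theorem weight_sum_smul (τ : Finset CoxVar) (c : CoxVar → ℝ) :
    weight (∑ m ∈ τ, c m • m.toPoint) = 8 * ∑ m ∈ τ, c m := by
  simp only [map_sum, map_smul, weight_toPoint, smul_eq_mul, Finset.mul_sum, mul_comm]

open Classical in
/-- The simplices of a triangulation as sets of Cox variables. -/
def coxFaces (K : Geometry.SimplicialComplex ℝ (Fin 5 → ℝ)) : Finset (Finset CoxVar) :=
  Finset.univ.filter fun τ => τ.map ⟨CoxVar.toPoint, CoxVar.toPoint_injective⟩ ∈ K.faces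

variable {K : Geometry.SimplicialComplex ℝ (Fin 5 → ℝ)}

theorem mem_coxFaces {τ : Finset CoxVar} :
    τ ∈ coxFaces K ↔ τ.map ⟨CoxVar.toPoint, CoxVar.toPoint_injective⟩ ∈ K.faces := by
  simp [coxFaces]

attribute [irreducible] coxFaces

theorem nonempty_of_mem_coxFaces {τ : Finset CoxVar} (hτ : τ ∈ coxFaces K) : τ.Nonempty := by
  have := K.nonempty_of_mem_faces (mem_coxFaces.1 hτ)
  simpa using this

theorem coxFaces_down_closed {τ τ' : Finset CoxVar} (hτ : τ ∈ coxFaces K) (h : τ' ⊆ τ)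
    (hne : τ'.Nonempty) : τ' ∈ coxFaces K :=
  mem_coxFaces.2 (K.down_closed (mem_coxFaces.1 hτ) (Finset.map_subset_map.2 h) (by simpa using hne))

theorem singleton_mem_coxFaces (hK : IsFineTriangulation K) (m : CoxVar) : {m} ∈ coxFaces K := by
  rw [mem_coxFaces, Finset.map_singleton]
  have : m.toPoint ∈ K.vertices := by rw [hK.vertices_eq]; exact ⟨m, rfl⟩
  exact this

/-- Vertices of faces are vertices of `K`, hence boundary lattice points; `coxFaces K` therefore
loses no face. -/
theorem exists_eq_map_of_mem_faces (hK : IsFineTriangulation K) {σ : Finset (Fin 5 → ℝ)}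
    (hσ : σ ∈ K.faces) :
    ∃ τ ∈ coxFaces K, σ = τ.map ⟨CoxVar.toPoint, CoxVar.toPoint_injective⟩ := by
  classical
  have h : σ = (Finset.univ.filter fun m : CoxVar => m.toPoint ∈ σ).map
      ⟨CoxVar.toPoint, CoxVar.toPoint_injective⟩ := by
    ext v
    simp only [Finset.mem_map, Finset.mem_filter, Finset.mem_univ, true_and,
      Function.Embedding.coeFn_mk]
    constructor
    · intro hv
      have hv' : v ∈ K.vertices := by
        rw [Geometry.SimplicialComplex.vertices_eq]
        exact Set.mem_biUnion hσ (Finset.mem_coe.2 hv)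
      rw [hK.vertices_eq] at hv'
      obtain ⟨m, rfl⟩ := hv'
      exact ⟨m, hv, rfl⟩
    · rintro ⟨m, hm, rfl⟩
      exact hm
  exact ⟨_, mem_coxFaces.2 (h ▸ hσ), h⟩

theorem sum_smul_mem_convexHull {τ : Finset CoxVar} {c : CoxVar → ℝ} (h0 : ∀ m ∈ τ, 0 ≤ c m)
    (h1 : ∑ m ∈ τ, c m = 1) :
    ∑ m ∈ τ, c m • m.toPoint ∈ convexHull ℝ
      (τ.map ⟨CoxVar.toPoint, CoxVar.toPoint_injective⟩ : Set (Fin 5 → ℝ)) := by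
  refine (convex_convexHull ℝ _).sum_mem h0 h1 fun m hm => subset_convexHull ℝ _ ?_
  exact Finset.mem_coe.2 (Finset.mem_map_of_mem ⟨CoxVar.toPoint, CoxVar.toPoint_injective⟩ hm)

theorem exists_of_mem_convexHull {τ : Finset CoxVar} {v : Fin 5 → ℝ}
    (hv : v ∈ convexHull ℝ (τ.map ⟨CoxVar.toPoint, CoxVar.toPoint_injective⟩ : Set (Fin 5 → ℝ))) :
    ∃ c : CoxVar → ℝ, (∀ m ∈ τ, 0 ≤ c m) ∧ ∑ m ∈ τ, c m = 1 ∧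
      ∑ m ∈ τ, c m • m.toPoint = v := by
  rw [Finset.mem_convexHull'] at hv
  obtain ⟨w, h0, h1, h2⟩ := hv
  rw [Finset.sum_map] at h1 h2
  exact ⟨fun m => w m.toPoint, fun m hm => h0 _ (by simpa using hm), h1, h2⟩

/-- A simplex of the triangulation lies in a facet. -/
theorem exists_coord_eq_zero (hK : IsFineTriangulation K) {τ : Finset CoxVar}
    (hτ : τ ∈ coxFaces K) : ∃ j, ∀ m ∈ τ, m.1 j = 0 := by
  have hne := nonempty_of_mem_coxFaces hτ
  have hpos : (0 : ℝ) < τ.card := by exact_mod_cast hne.card_pos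
  -- The barycentre lies on the boundary, so one of its coordinates vanishes; as an average of
  -- nonnegative numbers it vanishes only if that coordinate is zero at all vertices.
  have h1 := sum_smul_mem_convexHull (τ := τ) (c := fun _ => (τ.card : ℝ)⁻¹)
    (fun _ _ => by positivity) (by rw [Finset.sum_const, nsmul_eq_mul]; field_simp)
  have h2 := Geometry.SimplicialComplex.convexHull_subset_space (mem_coxFaces.1 hτ) h1
  rw [hK.space_eq] at h2
  obtain ⟨-, -, j, hj⟩ := h2
  refine ⟨j, fun m hm => ?_⟩
  simp only [Finset.sum_apply, Pi.smul_apply, smul_eq_mul] at hj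
  rw [Finset.sum_eq_zero_iff_of_nonneg (fun m _ => mul_nonneg (by positivity)
    (show (0 : ℝ) ≤ m.toPoint j from Nat.cast_nonneg _))] at hj
  have := hj m hm
  simpa [CoxVar.toPoint, hpos.ne'] using this

/-- The vertices lie on the hyperplane of weight `8`, which misses the origin, so affine
independence is linear independence. -/
theorem eq_zero_of_sum_smul_eq_zero {τ : Finset CoxVar} (hτ : τ ∈ coxFaces K) {c : CoxVar → ℝ}
    (h : ∑ m ∈ τ, c m • m.toPoint = 0) : ∀ m ∈ τ, c m = 0 := by
  classical
  have h1 := K.indep (mem_coxFaces.1 hτ)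
  have h2 : AffineIndependent ℝ fun m : τ => m.1.toPoint := by
    let e : τ ↪ (τ.map ⟨CoxVar.toPoint, CoxVar.toPoint_injective⟩ : Finset (Fin 5 → ℝ)) :=
      ⟨fun m => ⟨m.1.toPoint, by simp⟩, fun a b hab =>
        Subtype.ext (CoxVar.toPoint_injective (congrArg Subtype.val hab))⟩
    exact h1.comp_embedding e
  have hw : ∑ m ∈ τ, c m = 0 := by
    have := weight_sum_smul τ c
    rw [h, map_zero] at this
    linarith
  rw [affineIndependent_iff] at h2
  intro m hm
  refine h2 Finset.univ (fun m => c m.1) ?_ ?_ ⟨m, hm⟩ (Finset.mem_univ _)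
  · rw [← hw]; exact Finset.sum_coe_sort τ c
  · rw [← h]; exact Finset.sum_coe_sort τ fun m => c m • m.toPoint

theorem eq_of_sum_smul_eq {τ : Finset CoxVar} (hτ : τ ∈ coxFaces K) {c d : CoxVar → ℝ}
    (h : ∑ m ∈ τ, c m • m.toPoint = ∑ m ∈ τ, d m • m.toPoint) : ∀ m ∈ τ, c m = d m := by
  intro m hm
  refine sub_eq_zero.1 (eq_zero_of_sum_smul_eq_zero hτ (c := fun m => c m - d m) ?_ m hm)
  simp only [sub_smul, Finset.sum_sub_distrib, h, sub_self]

/-- The open simplex that contains a point is determined by the point. -/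
theorem subset_of_sum_smul_eq {τ τ' : Finset CoxVar} (hτ : τ ∈ coxFaces K) (hτ' : τ' ∈ coxFaces K)
    {c d : CoxVar → ℝ} (hc : ∀ m ∈ τ, 0 < c m) (hd : ∀ m ∈ τ', 0 < d m)
    (h : ∑ m ∈ τ, c m • m.toPoint = ∑ m ∈ τ', d m • m.toPoint) : τ ⊆ τ' := by
  classical
  set s := ∑ m ∈ τ, c m with hs
  have hs' : s = ∑ m ∈ τ', d m := by
    have := congrArg weight h
    rw [weight_sum_smul, weight_sum_smul] at this
    linarith
  have hspos : 0 < s := Finset.sum_pos hc (nonempty_of_mem_coxFaces hτ)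
  have key : ∀ (ρ : Finset CoxVar) (e : CoxVar → ℝ), ∑ m ∈ ρ, (s⁻¹ * e m) • m.toPoint =
      s⁻¹ • ∑ m ∈ ρ, e m • m.toPoint := by
    intro ρ e
    rw [Finset.smul_sum]
    simp only [mul_smul]
  have h1 := sum_smul_mem_convexHull (τ := τ) (c := fun m => s⁻¹ * c m)
    (fun m hm => (mul_pos (inv_pos.2 hspos) (hc m hm)).le)
    (by rw [← Finset.mul_sum, ← hs]; field_simp)
  have h2 := sum_smul_mem_convexHull (τ := τ') (c := fun m => s⁻¹ * d m)
    (fun m hm => (mul_pos (inv_pos.2 hspos) (hd m hm)).le)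
    (by rw [← Finset.mul_sum, ← hs']; field_simp)
  rw [key, ← h, ← key] at h2
  -- The normalised point lies in the hull of the common vertices; uniqueness of coordinates makes
  -- its coefficient zero at any vertex of `τ` outside `τ'`.
  have h3 := K.inter_subset_convexHull (mem_coxFaces.1 hτ) (mem_coxFaces.1 hτ') ⟨h1, h2⟩
  rw [← Finset.coe_inter, ← Finset.map_inter] at h3
  obtain ⟨e, -, -, he⟩ := exists_of_mem_convexHull h3
  have h4 : ∑ m ∈ τ, (if m ∈ τ' then e m else 0) • m.toPoint =
      ∑ m ∈ τ, (s⁻¹ * c m) • m.toPoint := by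
    rw [← he, ← Finset.filter_mem_eq_inter, Finset.sum_filter]
    refine Finset.sum_congr rfl fun m _ => ?_
    split_ifs <;> simp
  intro m hm
  by_contra hm'
  have h5 := eq_of_sum_smul_eq hτ h4 m hm
  rw [if_neg hm'] at h5
  exact (mul_pos (inv_pos.2 hspos) (hc m hm)).ne h5

/-- Scale `v` to weight `8`, where it lies in some simplex, and discard the vertices with
coefficient zero. -/
theorem exists_face_of_coord_eq_zero (hK : IsFineTriangulation K) (v : Fin 5 → ℝ)
    (h0 : ∀ i, 0 ≤ v i) (hv : ∃ i, v i = 0) (hw : 0 < weight v) :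
    ∃ τ ∈ coxFaces K, ∃ c : CoxVar → ℝ, (∀ m ∈ τ, 0 < c m) ∧ ∑ m ∈ τ, c m • m.toPoint = v := by
  classical
  obtain ⟨i, hi⟩ := hv
  have h1 : (8 / weight v) • v ∈ newtonBoundary := by
    refine ⟨fun i => mul_nonneg (by positivity) (h0 i), ?_, i, by simp [hi]⟩
    rw [← weight_apply, map_smul, smul_eq_mul]
    field_simp
  rw [← hK.space_eq, Geometry.SimplicialComplex.mem_space_iff] at h1
  obtain ⟨σ, hσ, h2⟩ := h1
  obtain ⟨τ, hτ, rfl⟩ := exists_eq_map_of_mem_faces hK hσ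
  obtain ⟨c, hc0, hc1, hc⟩ := exists_of_mem_convexHull h2
  refine ⟨τ.filter fun m => 0 < c m, ?_, fun m => weight v / 8 * c m, ?_, ?_⟩
  · refine coxFaces_down_closed hτ (Finset.filter_subset _ _) ?_
    by_contra hne
    rw [Finset.not_nonempty_iff_eq_empty, Finset.filter_eq_empty_iff] at hne
    have : ∑ m ∈ τ, c m ≤ 0 := Finset.sum_nonpos fun m hm => not_lt.1 (hne hm)
    linarith
  · intro m hm
    have := (Finset.mem_filter.1 hm).2
    positivity
  · have h3 : ∑ m ∈ τ, c m • m.toPoint = ∑ m ∈ τ.filter (fun m => 0 < c m), c m • m.toPoint := by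
      rw [Finset.sum_filter]
      refine Finset.sum_congr rfl fun m hm => ?_
      split_ifs with h
      · rfl
      · rw [le_antisymm (not_lt.1 h) (hc0 m hm), zero_smul]
    simp only [mul_smul]
    rw [← Finset.smul_sum, ← h3, hc, smul_smul]
    field_simp
    simp

/-- The number of vertices of a simplex in a coordinate subspace. -/
theorem card_add_card_le {τ : Finset CoxVar} (hτ : τ ∈ coxFaces K) (J : Finset (Fin 5))
    (hJ : ∀ j ∈ J, ∀ m ∈ τ, m.1 j = 0) : τ.card + J.card ≤ 5 := by
  classical
  -- The coordinates in `J` vanish on `τ`, so independence survives in a space of dimension `5 -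
  -- J.card`.
  have h1 : LinearIndependent ℝ fun (m : τ) (i : {i // i ∉ J}) => m.1.toPoint i.1 := by
    rw [Fintype.linearIndependent_iff]
    intro c hc m
    have h2 := eq_zero_of_sum_smul_eq_zero hτ
      (c := fun m => if h : m ∈ τ then c ⟨m, h⟩ else 0) (by
        ext i
        rw [Finset.sum_apply, Pi.zero_apply, ← Finset.sum_coe_sort]
        by_cases hi : i ∈ J
        · refine Finset.sum_eq_zero fun m _ => ?_
          simp [CoxVar.toPoint, hJ i hi m.1 m.2]
        · have := congrFun hc ⟨i, hi⟩
          simpa using this) m.1 m.2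
    simpa using h2
  have h2 := h1.fintype_card_le_finrank
  simp only [Fintype.card_coe, Module.finrank_fintype_fun_eq_card, Fintype.card_subtype_compl,
    Fintype.card_fin] at h2
  have := Finset.card_le_univ J
  simp only [Fintype.card_fin] at this
  omega

/-- Such a combination is a lattice point of the boundary, because `τ` lies in a facet; it is itself
a vertex of the triangulation, so the open simplex containing it is that single vertex. -/
theorem eq_zero_or_one_of_sum_smul_integral (hK : IsFineTriangulation K) {τ : Finset CoxVar}
    (hτ : τ ∈ coxFaces K) {c : CoxVar → ℝ} (hc : ∀ m ∈ τ, 0 ≤ c m) (h1 : ∑ m ∈ τ, c m = 1)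
    (hint : ∀ j, ∃ z : ℤ, ∑ m ∈ τ, c m * m.1 j = z) : ∀ m ∈ τ, c m = 0 ∨ c m = 1 := by
  classical
  choose z hz using hint
  have hz0 : ∀ j, 0 ≤ z j := fun j => by
    have : (0 : ℝ) ≤ z j := hz j ▸ Finset.sum_nonneg fun m hm => mul_nonneg (hc m hm) (by positivity)
    exact_mod_cast this
  have hzN : ∀ j, (((z j).toNat : ℕ) : ℝ) = z j := fun j => by
    exact_mod_cast Int.toNat_of_nonneg (hz0 j)
  have hsum : ∑ m ∈ τ, c m • m.toPoint = fun j => (((z j).toNat : ℕ) : ℝ) := by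
    ext j
    rw [hzN, ← hz j, Finset.sum_apply]
    rfl
  obtain ⟨j₀, hj₀⟩ := exists_coord_eq_zero hK hτ
  have hmem : (fun j => (z j).toNat) ∈ coxMonomials := by
    refine (mem_coxMonomials _).2 ⟨?_, ?_⟩
    · have := weight_sum_smul τ c
      rw [hsum, h1, weight_apply] at this
      norm_num at this
      exact_mod_cast this
    · intro h
      have h2 := hz j₀
      rw [Finset.sum_eq_zero fun m hm => by rw [hj₀ m hm]; simp] at h2
      have h3 := congrFun h j₀
      have h4 : z j₀ = 0 := by exact_mod_cast h2.symm
      simp [h4] at h3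
  set v : CoxVar := ⟨_, hmem⟩ with hv
  have hτ' : τ.filter (fun m => 0 < c m) ∈ coxFaces K := by
    refine coxFaces_down_closed hτ (Finset.filter_subset _ _) ?_
    by_contra hne
    rw [Finset.not_nonempty_iff_eq_empty, Finset.filter_eq_empty_iff] at hne
    have : ∑ m ∈ τ, c m ≤ 0 := Finset.sum_nonpos fun m hm => not_lt.1 (hne hm)
    linarith
  have h3 : ∑ m ∈ τ, c m • m.toPoint = ∑ m ∈ τ.filter (fun m => 0 < c m), c m • m.toPoint := by
    rw [Finset.sum_filter]
    refine Finset.sum_congr rfl fun m hm => ?_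
    split_ifs with h
    · rfl
    · rw [le_antisymm (not_lt.1 h) (hc m hm), zero_smul]
  have h4 : ∑ m ∈ τ.filter (fun m => 0 < c m), c m • m.toPoint =
      ∑ m ∈ {v}, (fun _ => (1 : ℝ)) m • m.toPoint := by
    rw [← h3, hsum, Finset.sum_singleton, one_smul]
    rfl
  have h5 := subset_of_sum_smul_eq hτ' (singleton_mem_coxFaces hK v)
    (fun m hm => (Finset.mem_filter.1 hm).2) (fun _ _ => one_pos) h4
  have hsub : ∀ m ∈ τ, m ≠ v → c m = 0 := by
    intro m hm hmv
    by_contra hne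
    have : m ∈ τ.filter fun m => 0 < c m :=
      Finset.mem_filter.2 ⟨hm, lt_of_le_of_ne (hc m hm) (Ne.symm hne)⟩
    exact hmv (Finset.mem_singleton.1 (h5 this))
  intro m hm
  by_cases hmv : m = v
  · right
    rw [← h1, Finset.sum_eq_single m (fun b hb hbm => hsub b hb fun h => hbm (h.trans hmv.symm))
      (fun h => absurd hm h)]
  · exact Or.inl (hsub m hm hmv)

/-- The cones over simplices with at most three vertices are unimodular. -/
theorem integral_of_sum_integral (hK : IsFineTriangulation K) {τ : Finset CoxVar}
    (hτ : τ ∈ coxFaces K) (hcard : τ.card ≤ 3) {c : CoxVar → ℝ}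
    (hint : ∀ j, ∃ z : ℤ, ∑ m ∈ τ, c m * ((m.1 j : ℝ) - 1) = z) :
    ∀ m ∈ τ, ∃ z : ℤ, c m = z := by
  classical
  choose z hz using hint
  obtain ⟨j₀, hj₀⟩ := exists_coord_eq_zero hK hτ
  -- On the coordinate `j₀` that vanishes on `τ`, every `m j₀ - 1` is `-1`, so the sum of the
  -- coefficients is an integer.
  have hs : ∑ m ∈ τ, c m = ((-z j₀ : ℤ) : ℝ) := by
    push_cast
    rw [← hz j₀, ← Finset.sum_neg_distrib]
    refine Finset.sum_congr rfl fun m hm => ?_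
    rw [hj₀ m hm]
    simp
  have hm : ∀ j, ∑ m ∈ τ, c m * (m.1 j : ℝ) = ((z j - z j₀ : ℤ) : ℝ) := by
    intro j
    have h1 := hz j
    simp only [mul_sub, mul_one, Finset.sum_sub_distrib, hs] at h1
    push_cast at h1 ⊢
    linarith
  set f : CoxVar → ℝ := fun m => Int.fract (c m) with hf
  have hfc : ∀ m, f m = c m - (⌊c m⌋ : ℤ) := fun m => rfl
  have hf0 : ∀ m, 0 ≤ f m := fun m => Int.fract_nonneg _
  have hf1 : ∀ m, f m < 1 := fun m => Int.fract_lt_one _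
  have hfs : ∑ m ∈ τ, f m = ((-z j₀ - ∑ m ∈ τ, ⌊c m⌋ : ℤ) : ℝ) := by
    simp only [hfc, Finset.sum_sub_distrib, hs]
    push_cast
    ring
  have hfm : ∀ j, ∑ m ∈ τ, f m * (m.1 j : ℝ) =
      ((z j - z j₀ - ∑ m ∈ τ, ⌊c m⌋ * (m.1 j : ℤ) : ℤ) : ℝ) := by
    intro j
    simp only [hfc, sub_mul, Finset.sum_sub_distrib, hm]
    push_cast
    ring
  have hres : ∀ m ∈ τ, f m = 0 ∨ f m = 1 := by
    set N : ℤ := -z j₀ - ∑ m ∈ τ, ⌊c m⌋ with hN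
    have hN0 : 0 ≤ N := by
      have : (0 : ℝ) ≤ N := hfs ▸ Finset.sum_nonneg fun m _ => hf0 m
      exact_mod_cast this
    have hNlt : N < τ.card := by
      have : (N : ℝ) < τ.card := by
        rw [← hfs, ← nsmul_one, ← Finset.sum_const]
        exact Finset.sum_lt_sum_of_nonempty (nonempty_of_mem_coxFaces hτ) fun m _ => hf1 m
      exact_mod_cast this
    -- `N` is the sum of the fractional parts. Sum `1` is a lattice point of the simplex, and sum
    -- `2` with three vertices is reflected to sum `1` by `f ↦ 1 - f`. Here the bound of three
    -- vertices is essential to the argument.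
    obtain h | h | ⟨h, hc3⟩ : N = 0 ∨ N = 1 ∨ (N = 2 ∧ τ.card = 3) := by omega
    · rw [h, Int.cast_zero, Finset.sum_eq_zero_iff_of_nonneg fun m _ => hf0 m] at hfs
      exact fun m hm => Or.inl (hfs m hm)
    · exact eq_zero_or_one_of_sum_smul_integral hK hτ (fun m _ => hf0 m)
        (by rw [hfs, h, Int.cast_one]) fun j => ⟨_, hfm j⟩
    · have h1 := eq_zero_or_one_of_sum_smul_integral hK hτ (c := fun m => 1 - f m)
        (fun m _ => sub_nonneg.2 (hf1 m).le)
        (by rw [Finset.sum_sub_distrib, hfs, h, Finset.sum_const, hc3]; norm_num)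
        fun j => ⟨∑ m ∈ τ, (m.1 j : ℤ) - (z j - z j₀ - ∑ m ∈ τ, ⌊c m⌋ * (m.1 j : ℤ)), by
          simp only [sub_mul, one_mul, Finset.sum_sub_distrib, hfm]
          push_cast
          ring⟩
      intro m hm
      rcases h1 m hm with h | h
      · right; linarith
      · left; linarith
  intro m hm
  rcases hres m hm with h | h
  · exact ⟨⌊c m⌋, by have := hfc m; linarith⟩
  · exact absurd h (hf1 m).ne

end Triangulation

/-! ### The numbers of simplices in the faces of the Newton polyhedron -/

section SimplexCount

/-- The coordinates that vanish on a set of monomials. -/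
def zeroCoords (τ : Finset CoxVar) : Finset (Fin 5) :=
  Finset.univ.filter fun j => ∀ m ∈ τ, m.1 j = 0

theorem mem_zeroCoords {τ : Finset CoxVar} {j : Fin 5} :
    j ∈ zeroCoords τ ↔ ∀ m ∈ τ, m.1 j = 0 := by
  simp [zeroCoords]

/-- The lattice points of degree `8 n` with zero coordinates exactly at `J`. -/
def latticePoints (J : Finset (Fin 5)) (n : ℕ) : Finset (Fin 5 → ℕ) :=
  (Fintype.piFinset fun _ => Finset.range (8 * n + 1)).filter fun x =>
    x 0 + x 1 + 2 * (x 2 + x 3 + x 4) = 8 * n ∧ ∀ j, x j = 0 ↔ j ∈ J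

theorem mem_latticePoints {J : Finset (Fin 5)} {n : ℕ} {x : Fin 5 → ℕ} :
    x ∈ latticePoints J n ↔
      x 0 + x 1 + 2 * (x 2 + x 3 + x 4) = 8 * n ∧ ∀ j, x j = 0 ↔ j ∈ J := by
  simp only [latticePoints, Finset.mem_filter, Fintype.mem_piFinset, Finset.mem_range,
    and_iff_right_iff_imp]
  rintro ⟨h, -⟩ i
  fin_cases i <;> simp <;> omega

open Classical in
/-- Compositions of `n` with parts indexed by `τ`. -/
def compositions {ι : Type*} (τ : Finset ι) (n : ℕ) : Finset (ι → ℕ) :=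
  (τ.piAntidiag n).filter fun k => ∀ m ∈ τ, k m ≠ 0

theorem mem_compositions {ι : Type*} {τ : Finset ι} {n : ℕ} {k : ι → ℕ} :
    k ∈ compositions τ n ↔ ∑ m ∈ τ, k m = n ∧ ∀ m, k m ≠ 0 ↔ m ∈ τ := by
  classical
  simp only [compositions, Finset.mem_filter, Finset.mem_piAntidiag]
  constructor
  · rintro ⟨⟨h1, h2⟩, h3⟩
    exact ⟨h1, fun m => ⟨h2 m, h3 m⟩⟩
  · rintro ⟨h1, h2⟩
    exact ⟨⟨h1, fun m => (h2 m).1⟩, fun m => (h2 m).2⟩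

theorem card_piAntidiag_nat {ι : Type*} [DecidableEq ι] (τ : Finset ι) (n : ℕ) :
    (τ.piAntidiag n).card = τ.card.multichoose n := by
  rw [← Finset.card_finsuppAntidiag_nat_eq_multichoose]
  symm
  refine Finset.card_bij (fun f _ => ⇑f) ?_ ?_ ?_
  · intro f hf
    rw [Finset.mem_finsuppAntidiag'] at hf
    rw [Finset.mem_piAntidiag]
    refine ⟨?_, fun i hi => hf.2 (by simpa using hi)⟩
    rw [← hf.1, Finsupp.sum, Finset.sum_subset hf.2]
    intro x _ hx
    simpa using hx
  · intro f _ g _ h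
    exact DFunLike.coe_injective h
  · intro g hg
    rw [Finset.mem_piAntidiag] at hg
    refine ⟨Finsupp.onFinset τ g hg.2, ?_, rfl⟩
    rw [Finset.mem_finsuppAntidiag]
    exact ⟨hg.1, Finsupp.support_onFinset_subset⟩

/-- Subtracting one from each part leaves a weak composition of `n - τ.card`. -/
theorem card_compositions {ι : Type*} (τ : Finset ι) (n : ℕ) :
    (compositions τ n).card = if τ.card ≤ n then τ.card.multichoose (n - τ.card) else 0 := by
  classical
  split_ifs with h
  · rw [← card_piAntidiag_nat]
    refine Finset.card_bij' (fun k _ m => k m - 1) (fun k _ m => if m ∈ τ then k m + 1 else 0)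
      ?_ ?_ ?_ ?_
    · intro k hk
      obtain ⟨h1, h2⟩ := mem_compositions.1 hk
      rw [Finset.mem_piAntidiag]
      refine ⟨?_, fun m hm => (h2 m).1 fun h => hm (by simp [h])⟩
      have h3 : ∑ m ∈ τ, (k m - 1 + 1) = n := by
        rw [← h1]
        exact Finset.sum_congr rfl fun m hm =>
          Nat.sub_add_cancel (Nat.one_le_iff_ne_zero.2 ((h2 m).2 hm))
      rw [Finset.sum_add_distrib, Finset.sum_const, smul_eq_mul, mul_one] at h3
      omega
    · intro k hk
      obtain ⟨h1, h2⟩ := Finset.mem_piAntidiag.1 hk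
      rw [mem_compositions]
      refine ⟨?_, fun m => by simp⟩
      rw [Finset.sum_congr rfl fun m hm => if_pos hm, Finset.sum_add_distrib, Finset.sum_const, h1,
        smul_eq_mul, mul_one]
      omega
    · intro k hk
      obtain ⟨h1, h2⟩ := mem_compositions.1 hk
      ext m
      dsimp only
      split_ifs with hm
      · exact Nat.sub_add_cancel (Nat.one_le_iff_ne_zero.2 ((h2 m).2 hm))
      · by_contra h3
        exact hm ((h2 m).1 (Ne.symm h3))
    · intro k hk
      obtain ⟨h1, h2⟩ := Finset.mem_piAntidiag.1 hk
      ext m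
      dsimp only
      split_ifs with hm
      · simp
      · by_contra h3
        exact hm (h2 m fun h => h3 (by simp [h]))
  · rw [Finset.card_eq_zero, Finset.eq_empty_iff_forall_notMem]
    intro k hk
    obtain ⟨h1, h2⟩ := mem_compositions.1 hk
    refine h ?_
    rw [← h1, Finset.card_eq_sum_ones]
    exact Finset.sum_le_sum fun m hm => Nat.one_le_iff_ne_zero.2 ((h2 m).2 hm)

variable {K : Geometry.SimplicialComplex ℝ (Fin 5 → ℝ)}

theorem toPoint_sum_natCast (τ : Finset CoxVar) (k : CoxVar → ℕ) :
    ∑ m ∈ τ, (k m : ℝ) • m.toPoint = fun j => ((∑ m ∈ τ, k m * m.1 j : ℕ) : ℝ) := by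
  ext j
  simp [Finset.sum_apply, CoxVar.toPoint]

/-- Lattice points in multiples of a face are counted by the simplices in its interior. -/
theorem card_latticePoints (hK : IsFineTriangulation K) (J : Finset (Fin 5)) (hJ : 2 ≤ J.card)
    (n : ℕ) (hn : 0 < n) :
    (latticePoints J n).card =
      ∑ τ ∈ (coxFaces K).filter fun τ => zeroCoords τ = J, (compositions τ n).card := by
  rw [← Finset.card_sigma]
  symm
  refine Finset.card_bij (fun z _ j => ∑ m ∈ z.1, z.2 m * m.1 j) ?_ ?_ ?_
  · rintro ⟨τ, k⟩ h
    simp only [Finset.mem_sigma, Finset.mem_filter, mem_compositions] at h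
    obtain ⟨⟨hτ, hτJ⟩, h1, h2⟩ := h
    rw [mem_latticePoints]
    constructor
    · rw [← h1, Finset.mul_sum, ← Finset.sum_add_distrib, ← Finset.sum_add_distrib,
        ← Finset.sum_add_distrib, Finset.mul_sum, ← Finset.sum_add_distrib]
      refine Finset.sum_congr rfl fun m _ => ?_
      rw [← m.weight_eq]
      ring
    · intro j
      rw [← hτJ, mem_zeroCoords, Finset.sum_eq_zero_iff]
      refine forall₂_congr fun m hm => ?_
      rw [mul_eq_zero]
      exact ⟨fun h => h.resolve_left ((h2 m).2 hm), Or.inr⟩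
  · rintro ⟨τ, k⟩ h ⟨τ', k'⟩ h' heq
    simp only [Finset.mem_sigma, Finset.mem_filter, mem_compositions] at h h'
    obtain ⟨⟨hτ, -⟩, -, h2⟩ := h
    obtain ⟨⟨hτ', -⟩, -, h2'⟩ := h'
    have e : ∑ m ∈ τ, (k m : ℝ) • m.toPoint = ∑ m ∈ τ', (k' m : ℝ) • m.toPoint := by
      rw [toPoint_sum_natCast, toPoint_sum_natCast]
      ext j
      exact congrArg Nat.cast (congrFun heq j)
    have hpos : ∀ m ∈ τ, (0 : ℝ) < k m := fun m hm => by
      exact_mod_cast Nat.pos_of_ne_zero ((h2 m).2 hm)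
    have hpos' : ∀ m ∈ τ', (0 : ℝ) < k' m := fun m hm => by
      exact_mod_cast Nat.pos_of_ne_zero ((h2' m).2 hm)
    have hττ' : τ = τ' := Finset.Subset.antisymm
      (subset_of_sum_smul_eq hτ hτ' hpos hpos' e) (subset_of_sum_smul_eq hτ' hτ hpos' hpos e.symm)
    subst hττ'
    have hk : k = k' := by
      ext m
      by_cases hm : m ∈ τ
      · exact_mod_cast eq_of_sum_smul_eq hτ e m hm
      · rw [not_not.1 (mt (h2 m).1 hm), not_not.1 (mt (h2' m).1 hm)]
    rw [hk]
  · intro x hx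
    rw [mem_latticePoints] at hx
    obtain ⟨hx1, hx2⟩ := hx
    have hJne : ∃ j, j ∈ J := Finset.card_pos.1 (by omega)
    have hxw : weight (fun i => (x i : ℝ)) = 8 * n := by
      rw [weight_apply]
      exact_mod_cast hx1
    have hnR : (0 : ℝ) < n := by exact_mod_cast hn
    obtain ⟨τ, hτ, c, hc, hcx⟩ := exists_face_of_coord_eq_zero hK (fun i => (x i : ℝ))
      (fun i => Nat.cast_nonneg _) (by
        obtain ⟨j, hj⟩ := hJne
        exact ⟨j, by rw [(hx2 j).2 hj, Nat.cast_zero]⟩) (by rw [hxw]; positivity)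
    have hcs : ∑ m ∈ τ, c m = n := by
      have := weight_sum_smul τ c
      rw [hcx, hxw] at this
      linarith
    have hcj : ∀ j, ∑ m ∈ τ, c m * m.1 j = x j := fun j => by
      have := congrFun hcx j
      rw [Finset.sum_apply] at this
      exact this
    have hz : zeroCoords τ = J := by
      ext j
      rw [mem_zeroCoords, ← hx2 j, ← Nat.cast_eq_zero (R := ℝ), ← hcj j,
        Finset.sum_eq_zero_iff_of_nonneg
          (fun m hm => mul_nonneg (hc m hm).le (Nat.cast_nonneg _))]
      refine forall₂_congr fun m hm => ?_
      rw [mul_eq_zero, Nat.cast_eq_zero]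
      exact ⟨Or.inr, fun h => h.resolve_left (hc m hm).ne'⟩
    -- This is where `2 ≤ J.card` enters: it makes `τ` small enough to be unimodular, so the real
    -- coefficients are integers.
    have hcard : τ.card ≤ 3 := by
      have := card_add_card_le hτ J fun j hj m hm => mem_zeroCoords.1 (hz ▸ hj) m hm
      omega
    have hint := integral_of_sum_integral hK hτ hcard (c := c) fun j => ⟨x j - n, by
      simp only [mul_sub, mul_one, Finset.sum_sub_distrib, hcs, hcj]
      push_cast
      ring⟩
    have hnat : ∀ m, ∃ k : ℕ, (m ∈ τ → c m = k) ∧ (k ≠ 0 ↔ m ∈ τ) := by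
      intro m
      by_cases hm : m ∈ τ
      · obtain ⟨z, hz⟩ := hint m hm
        have hzpos : 0 < z := by
          have := hc m hm
          rw [hz] at this
          exact_mod_cast this
        refine ⟨z.toNat, fun _ => ?_, by simpa [hm] using hzpos⟩
        rw [hz]
        exact_mod_cast (Int.toNat_of_nonneg hzpos.le).symm
      · exact ⟨0, fun h => absurd h hm, by simp [hm]⟩
    choose k hk1 hk2 using hnat
    refine ⟨⟨τ, k⟩, ?_, ?_⟩
    · simp only [Finset.mem_sigma, Finset.mem_filter, mem_compositions]
      refine ⟨⟨hτ, hz⟩, ?_, hk2⟩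
      have : ((∑ m ∈ τ, k m : ℕ) : ℝ) = n := by
        push_cast
        rw [← hcs]
        exact Finset.sum_congr rfl fun m hm => (hk1 m hm).symm
      exact_mod_cast this
    · ext j
      have : ((∑ m ∈ τ, k m * m.1 j : ℕ) : ℝ) = x j := by
        push_cast
        rw [← hcj]
        exact Finset.sum_congr rfl fun m hm => by rw [hk1 m hm]
      exact_mod_cast this

attribute [irreducible] compositions latticePoints

/-- The number of simplices with `t` vertices in the interior of the face `J`. -/
def simplexCount (K : Geometry.SimplicialComplex ℝ (Fin 5 → ℝ)) (J : Finset (Fin 5)) (t : ℕ) : ℕ :=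
  ((coxFaces K).filter fun τ => zeroCoords τ = J ∧ τ.card = t).card

attribute [irreducible] simplexCount

/-- Sums over the simplices in the interior of a face of dimension at most two. -/
theorem sum_faces_eq {R : Type*} [AddCommMonoid R] (J : Finset (Fin 5))
    (hJ : 2 ≤ J.card) (f : ℕ → R) :
    ∑ τ ∈ (coxFaces K).filter (fun τ => zeroCoords τ = J), f τ.card =
      simplexCount K J 1 • f 1 + simplexCount K J 2 • f 2 + simplexCount K J 3 • f 3 := by
  rw [← Finset.sum_fiberwise_of_maps_to (g := Finset.card) (t := {1, 2, 3})]
  · rw [Finset.sum_insert (by simp), Finset.sum_insert (by simp), Finset.sum_singleton, ← add_assoc]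
    have h : ∀ t, ∑ τ ∈ ((coxFaces K).filter (fun τ => zeroCoords τ = J)).filter
        (fun τ => τ.card = t), f τ.card = simplexCount K J t • f t := by
      intro t
      rw [Finset.sum_congr rfl (g := fun _ => f t) fun τ hτ => by rw [(Finset.mem_filter.1 hτ).2],
        Finset.sum_const, Finset.filter_filter]
      unfold simplexCount
      rfl
    rw [h, h, h]
  · intro τ hτ
    obtain ⟨hτ, hz⟩ := Finset.mem_filter.1 hτ
    have h1 := card_add_card_le hτ J fun j hj m hm => mem_zeroCoords.1 (hz ▸ hj) m hm
    have h2 := (nonempty_of_mem_coxFaces hτ).card_pos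
    simp only [Finset.mem_insert, Finset.mem_singleton]
    omega

theorem card_latticePoints_one (hK : IsFineTriangulation K) (J : Finset (Fin 5))
    (hJ : 2 ≤ J.card) : (latticePoints J 1).card = simplexCount K J 1 := by
  rw [card_latticePoints hK J hJ 1 one_pos]
  simp only [card_compositions]
  rw [sum_faces_eq J hJ fun t => if t ≤ 1 then t.multichoose (1 - t) else 0]
  generalize simplexCount K J 1 = a, simplexCount K J 2 = b, simplexCount K J 3 = c
  simp

theorem card_latticePoints_two (hK : IsFineTriangulation K) (J : Finset (Fin 5))
    (hJ : 2 ≤ J.card) :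
    (latticePoints J 2).card = simplexCount K J 1 + simplexCount K J 2 := by
  rw [card_latticePoints hK J hJ 2 two_pos]
  simp only [card_compositions]
  rw [sum_faces_eq J hJ fun t => if t ≤ 2 then t.multichoose (2 - t) else 0]
  generalize simplexCount K J 1 = a, simplexCount K J 2 = b, simplexCount K J 3 = c
  simp

/-- The number `3` has `1`, `2`, `1` compositions into one, two, three positive parts. Together with
degrees one and two this is a triangular system for the simplex counts. -/
theorem card_latticePoints_three (hK : IsFineTriangulation K) (J : Finset (Fin 5))
    (hJ : 2 ≤ J.card) :
    (latticePoints J 3).card =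
      simplexCount K J 1 + 2 * simplexCount K J 2 + simplexCount K J 3 := by
  rw [card_latticePoints hK J hJ 3 three_pos]
  simp only [card_compositions]
  rw [sum_faces_eq J hJ fun t => if t ≤ 3 then t.multichoose (3 - t) else 0]
  generalize simplexCount K J 1 = a, simplexCount K J 2 = b, simplexCount K J 3 = c
  simp
  ring

/-- The number of `x ∈ ℕ^k` of degree `T` for the weights `w` with zeros exactly where `z` is
true, computed recursively. -/
def degreeCount : (k : ℕ) → (Fin k → ℕ) → (Fin k → Bool) → ℕ → ℕ
  | 0, _, _, T => if T = 0 then 1 else 0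
  | k + 1, w, z, T => ∑ v ∈ Finset.range (if z 0 then 1 else T + 1),
    if decide (v = 0) = z 0 ∧ w 0 * v ≤ T then
      degreeCount k (fun i => w i.succ) (fun i => z i.succ) (T - w 0 * v) else 0

/-- Makes lattice point counts computable: the recursion prunes values exceeding the remaining
degree, whereas `latticePoints J 3` filters a box of `25 ^ 5` points. -/
theorem exists_finset_card_eq_degreeCount (k : ℕ) (w : Fin k → ℕ) (hw : ∀ i, 0 < w i)
    (z : Fin k → Bool) (T : ℕ) : ∃ D : Finset (Fin k → ℕ),
      (∀ x, x ∈ D ↔ ∑ i, w i * x i = T ∧ ∀ i, decide (x i = 0) = z i) ∧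
        D.card = degreeCount k w z T := by
  classical
  induction k generalizing T with
  | zero =>
    by_cases hT : T = 0
    · exact ⟨{default}, fun x => by simp [hT, Subsingleton.elim x default], by simp [degreeCount, hT]⟩
    · exact ⟨∅, fun x => by simpa using fun h => hT h.symm, by simp [degreeCount, hT]⟩
  | succ k ih =>
    choose D hD hDc using fun T => ih (fun i => w i.succ) (fun i => hw i.succ) (fun i => z i.succ) T
    have hite : ∀ (c : Prop) [Decidable c] (A : Finset (Fin (k + 1) → ℕ)) (x : Fin (k + 1) → ℕ),
        (x ∈ if c then A else ∅) ↔ c ∧ x ∈ A := by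
      intro c _ A x
      split_ifs with h <;> simp [h]
    refine ⟨(Finset.range (if z 0 then 1 else T + 1)).biUnion fun v =>
      if decide (v = 0) = z 0 ∧ w 0 * v ≤ T then (D (T - w 0 * v)).image (Fin.cons (α := fun _ => ℕ) v) else ∅,
      fun x => ?_, ?_⟩
    · simp only [Finset.mem_biUnion, Finset.mem_range, hite, Finset.mem_image,
        hD, Fin.sum_univ_succ, Fin.forall_fin_succ]
      constructor
      · rintro ⟨v, -, ⟨h1, h2⟩, y, ⟨h3, h4⟩, rfl⟩
        simp only [Fin.cons_zero, Fin.cons_succ]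
        exact ⟨by omega, h1, h4⟩
      · rintro ⟨h1, h2, h3⟩
        have h4 : x 0 ≤ w 0 * x 0 := Nat.le_mul_of_pos_left _ (hw 0)
        have h5 : x 0 < if z 0 then 1 else T + 1 := by
          split_ifs with h
          · rw [h, decide_eq_true_eq] at h2
            omega
          · omega
        exact ⟨x 0, h5, ⟨h2, by omega⟩, Fin.tail x, ⟨by simp only [Fin.tail]; omega, h3⟩,
          Fin.cons_self_tail x⟩
    · rw [Finset.card_biUnion]
      · rw [degreeCount]
        refine Finset.sum_congr rfl fun v _ => ?_
        split_ifs
        · rw [Finset.card_image_of_injective _ (Fin.cons_right_injective (α := fun _ => ℕ) v), hDc]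
        · rfl
      · intro a _ b _ hab
        rw [Function.onFun, Finset.disjoint_left]
        intro x hxa hxb
        simp only [hite, Finset.mem_image] at hxa hxb
        obtain ⟨-, y, -, rfl⟩ := hxa
        obtain ⟨-, y', -, h⟩ := hxb
        have := congrFun h 0
        simp only [Fin.cons_zero] at this
        exact hab this.symm

theorem card_latticePoints_eq_degreeCount (J : Finset (Fin 5)) (n : ℕ) :
    (latticePoints J n).card =
      degreeCount 5 ![1, 1, 2, 2, 2] (fun i => decide (i ∈ J)) (8 * n) := by
  obtain ⟨D, hD, hDc⟩ := exists_finset_card_eq_degreeCount 5 ![1, 1, 2, 2, 2] (by decide)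
    (fun i => decide (i ∈ J)) (8 * n)
  rw [← hDc]
  congr 1
  ext x
  rw [mem_latticePoints, hD]
  simp only [Fin.sum_univ_five, decide_eq_decide]
  refine and_congr_left fun _ => ?_
  simp only [Matrix.cons_val]
  omega

/-- The numbers of vertices, edges and triangles in the interior of the face `J`, as determined by
the numbers of lattice points. -/
theorem simplexCount_eq {K : Geometry.SimplicialComplex ℝ (Fin 5 → ℝ)} (hK : IsFineTriangulation K)
    (J : Finset (Fin 5)) (hJ : 2 ≤ J.card) (a b c : ℕ)
    (h1 : degreeCount 5 ![1, 1, 2, 2, 2] (fun i => decide (i ∈ J)) 8 = a)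
    (h2 : degreeCount 5 ![1, 1, 2, 2, 2] (fun i => decide (i ∈ J)) 16 = a + b)
    (h3 : degreeCount 5 ![1, 1, 2, 2, 2] (fun i => decide (i ∈ J)) 24 = a + 2 * b + c) :
    simplexCount K J 1 = a ∧ simplexCount K J 2 = b ∧ simplexCount K J 3 = c := by
  have e1 := card_latticePoints_one hK J hJ
  have e2 := card_latticePoints_two hK J hJ
  have e3 := card_latticePoints_three hK J hJ
  rw [card_latticePoints_eq_degreeCount] at e1 e2 e3
  rw [show 8 * 1 = 8 from rfl, h1] at e1
  rw [show 8 * 2 = 16 from rfl, h2] at e2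
  rw [show 8 * 3 = 24 from rfl, h3] at e3
  omega

end SimplexCount

/-! ### Counting the points of the mirror by strata -/

section Strata

variable {F : Type*} [Field F] {K : Geometry.SimplicialComplex ℝ (Fin 5 → ℝ)}

open Classical in
/-- The coordinates that vanish at a point. -/
def zeroSet (x : CoxVar → F) : Finset CoxVar := Finset.univ.filter fun m => x m = 0

theorem mem_zeroSet {x : CoxVar → F} {m : CoxVar} : m ∈ zeroSet x ↔ x m = 0 := by
  simp [zeroSet]

theorem isAdmissible_iff (hK : IsFineTriangulation K) (x : CoxVar → F) :
    IsAdmissible K x ↔ zeroSet x = ∅ ∨ zeroSet x ∈ coxFaces K := by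
  classical
  constructor
  · rintro ⟨σ, hσ, h⟩
    rcases (zeroSet x).eq_empty_or_nonempty with h0 | h0
    · exact Or.inl h0
    · right
      obtain ⟨τ, hτ, rfl⟩ := exists_eq_map_of_mem_faces hK hσ
      refine coxFaces_down_closed hτ (fun m hm => ?_) h0
      obtain ⟨m', hm', hmm'⟩ := Finset.mem_map.1 (h m (mem_zeroSet.1 hm))
      exact CoxVar.toPoint_injective hmm' ▸ hm'
  · rintro (h | h)
    -- The empty set is not a face, but any vertex contains it; this one is an arbitrary choice.
    · refine ⟨_, mem_coxFaces.1 (singleton_mem_coxFaces hK (coxVarMk 8 0 0 0 0 rfl (by decide))),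
        fun m hm => ?_⟩
      rw [← mem_zeroSet, h] at hm
      exact absurd hm (Finset.notMem_empty m)
    · exact ⟨_, mem_coxFaces.1 h, fun m hm => Finset.mem_map_of_mem
        ⟨CoxVar.toPoint, CoxVar.toPoint_injective⟩ (mem_zeroSet.2 hm)⟩

open Classical in
/-- The point obtained from units by setting the coordinates in `τ` to zero. -/
def mask (τ : Finset CoxVar) (u : CoxVar → Fˣ) : CoxVar → F := fun m => if m ∈ τ then 0 else u m

theorem zeroSet_mask (τ : Finset CoxVar) (u : CoxVar → Fˣ) : zeroSet (mask τ u) = τ := by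
  ext m
  rw [mem_zeroSet, mask]
  split_ifs with h <;> simp [h]

theorem exists_mask_eq (x : CoxVar → F) : ∃ u, mask (zeroSet x) u = x := by
  classical
  refine ⟨fun m => if h : x m = 0 then 1 else Units.mk0 (x m) h, funext fun m => ?_⟩
  by_cases h : x m = 0 <;> simp [mask, mem_zeroSet, h]

open Classical in
theorem prod_mask_pow (τ : Finset CoxVar) (u : CoxVar → Fˣ) (e : CoxVar → ℕ) :
    ∏ m, mask τ u m ^ e m =
      if ∀ m ∈ τ, e m = 0 then ((monomialHom e u : Fˣ) : F) else 0 := by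
  split_ifs with h
  · rw [monomialHom_apply, Units.coe_prod]
    refine Finset.prod_congr rfl fun m _ => ?_
    by_cases hm : m ∈ τ
    · simp [h m hm]
    · simp [mask, hm]
  · push Not at h
    obtain ⟨m, hm, hem⟩ := h
    exact Finset.prod_eq_zero (Finset.mem_univ m) (by simp [mask, hm, hem])

/-- A monomial survives exactly when its exponents vanish on `τ`. The `ψ` term always dies, and the
`φ` term survives exactly when both coordinates of weight one vanish on `τ`, since an even sum with
zero half is zero. -/
theorem mirrorPoly_mask (φ ψ : F) {τ : Finset CoxVar} (hτ : τ.Nonempty) (u : CoxVar → Fˣ) :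
    mirrorPoly φ ψ (mask τ u) = facePoly (zeroCoords τ) φ u := by
  classical
  have h1 : ∀ j : Fin 5, ∏ m, mask τ u m ^ m.1 j =
      if j ∈ zeroCoords τ then ((coordMonomial j u : Fˣ) : F) else 0 := by
    intro j
    rw [prod_mask_pow τ u fun m => m.1 j]
    simp only [mem_zeroCoords]
    rfl
  have h2 : ∏ m, mask τ u m ^ ((m.1 0 + m.1 1) / 2) =
      if 0 ∈ zeroCoords τ ∧ 1 ∈ zeroCoords τ then ((midMonomial u : Fˣ) : F) else 0 := by
    rw [prod_mask_pow τ u fun m => (m.1 0 + m.1 1) / 2]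
    have : (∀ m ∈ τ, (m.1 0 + m.1 1) / 2 = 0) ↔ 0 ∈ zeroCoords τ ∧ 1 ∈ zeroCoords τ := by
      rw [mem_zeroCoords, mem_zeroCoords, ← forall₂_and]
      refine forall₂_congr fun m _ => ?_
      have := m.weight_eq
      omega
    rw [if_congr this rfl rfl]
    rfl
  have h3 : ∏ m, mask τ u m = 0 := by
    obtain ⟨m, hm⟩ := hτ
    exact Finset.prod_eq_zero (Finset.mem_univ m) (by simp [mask, hm])
  rw [mirrorPoly, Finset.sum_congr rfl fun j _ => h1 j, h2, h3, facePoly, ← Finset.sum_filter]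
  rw [mul_zero, sub_zero]
  congr 1
  · congr 1
    ext j
    simp
  · split_ifs <;> simp

/-- The hypersurface does not meet the strata in the interior of facets. -/
theorem two_le_card_zeroCoords (hK : IsFineTriangulation K) {φ ψ : F} {x : CoxVar → F}
    (hx : zeroSet x ∈ coxFaces K) (hP : mirrorPoly φ ψ x = 0) :
    2 ≤ (zeroCoords (zeroSet x)).card := by
  obtain ⟨j, hj⟩ := exists_coord_eq_zero hK hx
  by_contra hlt
  have h1 : (zeroCoords (zeroSet x)).card = 1 := by
    have := Finset.card_pos.2 ⟨j, mem_zeroCoords.2 hj⟩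
    omega
  obtain ⟨i, hi⟩ := Finset.card_eq_one.1 h1
  obtain ⟨u, hu⟩ := exists_mask_eq x
  rw [← hu, mirrorPoly_mask φ ψ (nonempty_of_mem_coxFaces hx), hi, facePoly, if_neg,
    Finset.sum_singleton, sub_zero] at hP
  · exact (coordMonomial i u).ne_zero hP
  · rintro ⟨h0, h1⟩
    exact absurd ((Finset.mem_singleton.1 h0).trans (Finset.mem_singleton.1 h1).symm) (by decide)

theorem smul_apply_coxGroup (g : coxGroup F) (x : CoxVar → F) (m : CoxVar) :
    (g • x) m = (g.1 m : F) * x m := rfl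

theorem zeroSet_smul (g : coxGroup F) (x : CoxVar → F) : zeroSet (g • x) = zeroSet x := by
  ext m
  simp [mem_zeroSet, smul_apply_coxGroup]

theorem mirrorPoly_smul (φ ψ : F) (g : coxGroup F) (x : CoxVar → F) :
    mirrorPoly φ ψ (g • x) = (prodMonomial g.1 : Fˣ) * mirrorPoly φ ψ x := by
  have h : ∀ e : CoxVar → ℕ, ∏ m, (g • x) m ^ e m =
      ((monomialHom e g.1 : Fˣ) : F) * ∏ m, x m ^ e m := by
    intro e
    simp only [smul_apply_coxGroup, mul_pow, Finset.prod_mul_distrib, monomialHom_apply,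
      Units.coe_prod, Units.val_pow_eq_pow_val]
  have h1 : ∀ j : Fin 5, ∏ m, (g • x) m ^ m.1 j =
      ((prodMonomial g.1 : Fˣ) : F) * ∏ m, x m ^ m.1 j := fun j => by
    rw [h fun m => m.1 j, ← (mem_coxGroup_iff g.1).1 g.2 j]
    rfl
  have h2 := h fun m => (m.1 0 + m.1 1) / 2
  rw [show monomialHom (fun m : CoxVar => (m.1 0 + m.1 1) / 2) g.1 = prodMonomial g.1 from
    midMonomial_of_mem_coxGroup g.2] at h2
  have h3 := h fun _ => 1
  simp only [pow_one] at h3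
  rw [mirrorPoly, Finset.sum_congr rfl fun j _ => h1 j, h2, h3, mirrorPoly, ← Finset.mul_sum]
  change _ - _ - 8 * ψ * (((prodMonomial g.1 : Fˣ) : F) * _) = _
  ring

theorem smul_mem_mirrorCone (hK : IsFineTriangulation K) {φ ψ : F} {x : CoxVar → F}
    (hx : x ∈ mirrorCone K φ ψ) (g : coxGroup F) : g • x ∈ mirrorCone K φ ψ := by
  refine ⟨?_, ?_⟩
  · rw [isAdmissible_iff hK, zeroSet_smul, ← isAdmissible_iff hK]
    exact hx.1
  · rw [mirrorPoly_smul, hx.2, mul_zero]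

variable [Fintype F]

/-- The points of the hypersurface have trivial stabilizers. -/
theorem eq_one_of_smul_eq (hK : IsFineTriangulation K) {φ ψ : F} {x : CoxVar → F}
    (hx : x ∈ mirrorCone K φ ψ) (g : coxGroup F) (hg : g • x = x) : g = 1 := by
  classical
  have hg1 : ∀ m, m ∉ zeroSet x → g.1 m = 1 := by
    intro m hm
    have h1 := congrFun hg m
    rw [smul_apply_coxGroup] at h1
    rw [mem_zeroSet] at hm
    exact Units.ext (mul_right_cancel₀ hm (h1.trans (one_mul _).symm))
  obtain ⟨hadm, hP⟩ := hx
  refine Subtype.ext (funext fun m => ?_)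
  rcases (isAdmissible_iff hK x).1 hadm with h | hτ
  · exact hg1 m (h ▸ Finset.notMem_empty m)
  by_cases hm : m ∈ zeroSet x
  · have hcard : (zeroSet x).card ≤ 3 := by
      have h1 := two_le_card_zeroCoords hK hτ hP
      have h2 := card_add_card_le hτ (zeroCoords (zeroSet x)) fun j hj => mem_zeroCoords.1 hj
      omega
    -- Writing `g m = γ ^ a m`, the group equations say that the numbers `a m / orderOf γ` have
    -- integral combinations with the `m j - 1`; unimodularity makes them integers, so `g m = 1`.
    obtain ⟨γ, hγ⟩ := IsCyclic.exists_generator (α := Fˣ)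
    choose a ha using fun m => Subgroup.mem_zpowers_iff.1 (hγ (g.1 m))
    have hord : (0 : ℝ) < orderOf γ := by exact_mod_cast orderOf_pos γ
    obtain ⟨z, hz⟩ := integral_of_sum_integral hK hτ hcard (c := fun m => (a m : ℝ) / orderOf γ)
      (fun j => by
        have h1 : ∏ m, g.1 m ^ ((m.1 j : ℤ) - 1) = 1 := g.2 j
        have h2 : ∏ m ∈ zeroSet x, g.1 m ^ ((m.1 j : ℤ) - 1) = 1 := by
          rw [← h1]
          exact Finset.prod_subset (Finset.subset_univ _) fun m _ hm => by rw [hg1 m hm, one_zpow]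
        have h3 : γ ^ ∑ m ∈ zeroSet x, a m * ((m.1 j : ℤ) - 1) = 1 := by
          have h4 : ∀ s : Finset CoxVar, γ ^ ∑ m ∈ s, a m * ((m.1 j : ℤ) - 1) =
              ∏ m ∈ s, γ ^ (a m * ((m.1 j : ℤ) - 1)) := by
            intro s
            induction s using Finset.induction_on with
            | empty => simp
            | insert m s hm ih => rw [Finset.sum_insert hm, Finset.prod_insert hm, zpow_add, ih]
          rw [← h2, h4]
          exact Finset.prod_congr rfl fun m _ => by rw [zpow_mul, ha]
        obtain ⟨z, hz⟩ := orderOf_dvd_iff_zpow_eq_one.2 h3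
        refine ⟨z, ?_⟩
        have h4 := congrArg (Int.cast : ℤ → ℝ) hz
        push_cast at h4
        simp only [div_mul_eq_mul_div]
        rw [← Finset.sum_div, h4]
        field_simp) m hm
    rw [div_eq_iff hord.ne'] at hz
    have hz' : a m = z * orderOf γ := by exact_mod_cast hz
    rw [← ha m, hz', mul_comm, zpow_mul, zpow_natCast, pow_orderOf_eq_one, one_zpow]
    rfl
  · exact hg1 m hm

theorem mirrorCount_mul_card (hK : IsFineTriangulation K) (φ ψ : F) :
    mirrorCount K φ ψ * Nat.card (coxGroup F) = (mirrorCone K φ ψ).ncard := by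
  classical
  set C := mirrorCone K φ ψ with hC
  set f : (CoxVar → F) → Set (CoxVar → F) := fun x => MulAction.orbit (coxGroup F) x with hf
  rw [mirrorCount, Set.ncard_eq_toFinset_card' C]
  have h1 : (f '' C) = ((C.toFinset.image f : Finset _) : Set (Set (CoxVar → F))) := by simp
  rw [h1, Set.ncard_coe_finset, Finset.card_eq_sum_card_image f C.toFinset,
    Finset.sum_congr rfl (g := fun _ => Nat.card (coxGroup F)), Finset.sum_const, smul_eq_mul]
  intro o ho
  obtain ⟨x, hx, rfl⟩ := Finset.mem_image.1 ho
  rw [Set.mem_toFinset] at hx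
  have h2 : (C.toFinset.filter fun y => f y = f x) =
      Finset.univ.image fun g : coxGroup F => g • x := by
    ext y
    simp only [Finset.mem_filter, Set.mem_toFinset, Finset.mem_image, Finset.mem_univ, true_and, hf]
    rw [MulAction.orbit_eq_iff]
    constructor
    · rintro ⟨-, g, rfl⟩
      exact ⟨g, rfl⟩
    · rintro ⟨g, rfl⟩
      exact ⟨smul_mem_mirrorCone hK hx g, g, rfl⟩
  rw [h2, Finset.card_image_of_injective, Finset.card_univ, Nat.card_eq_fintype_card]
  intro g g' hgg'
  have h3 := eq_one_of_smul_eq hK hx (g'⁻¹ * g) (by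
    have : g • x = g' • x := hgg'
    rw [mul_smul, this, inv_smul_smul])
  exact (inv_mul_eq_one.1 h3).symm

open Classical in
-- Each point of the stratum has `Fintype.card Fˣ ^ τ.card` preimages under `mask τ`, because the
-- masked units are free.
theorem card_stratum (φ ψ : F) {τ : Finset CoxVar} (hτ : τ.Nonempty) :
    (Finset.univ.filter fun x : CoxVar → F => zeroSet x = τ ∧ mirrorPoly φ ψ x = 0).card *
      Fintype.card Fˣ ^ τ.card = faceCount (zeroCoords τ) φ := by
  unfold faceCount
  rw [Finset.card_eq_sum_card_fiberwise (f := mask τ)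
    (t := Finset.univ.filter fun x : CoxVar → F => zeroSet x = τ ∧ mirrorPoly φ ψ x = 0)]
  · rw [Finset.sum_congr rfl (g := fun _ => Fintype.card Fˣ ^ τ.card), Finset.sum_const,
      smul_eq_mul]
    intro x hx
    simp only [Finset.mem_filter, Finset.mem_univ, true_and] at hx
    obtain ⟨hx1, hx2⟩ := hx
    obtain ⟨v, hv⟩ := exists_mask_eq x
    rw [hx1] at hv
    have h1 : ((Finset.univ.filter fun u : CoxVar → Fˣ => facePoly (zeroCoords τ) φ u = 0).filter
        fun u => mask τ u = x) =
        Fintype.piFinset fun m => if m ∈ τ then Finset.univ else {v m} := by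
      ext u
      simp only [Finset.mem_filter, Finset.mem_univ, true_and, Fintype.mem_piFinset]
      constructor
      · rintro ⟨-, h⟩ m
        rw [← hv] at h
        have := congrFun h m
        split_ifs with hm
        · exact Finset.mem_univ _
        · simp only [mask, if_neg hm] at this
          exact Finset.mem_singleton.2 (Units.ext this)
      · intro h
        have h2 : mask τ u = x := by
          rw [← hv]
          ext m
          have := h m
          by_cases hm : m ∈ τ
          · simp [mask, hm]
          · rw [if_neg hm, Finset.mem_singleton] at this
            simp [mask, this]
        exact ⟨by rw [← mirrorPoly_mask φ ψ hτ, h2, hx2], h2⟩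
    rw [h1, Fintype.card_piFinset]
    have h3 : ∀ m, (if m ∈ τ then Finset.univ else {v m} : Finset Fˣ).card =
        if m ∈ τ then Fintype.card Fˣ else 1 := by
      intro m
      split_ifs <;> simp
    rw [Finset.prod_congr rfl fun m _ => h3 m, Finset.prod_ite_mem, Finset.univ_inter,
      Finset.prod_const]
  · intro u hu
    simp only [Finset.coe_filter, Finset.mem_univ, true_and, Set.mem_ofPred_eq] at hu ⊢
    exact ⟨zeroSet_mask τ u, by rw [mirrorPoly_mask φ ψ hτ, hu]⟩

open Classical in
theorem ncard_mirrorCone (hK : IsFineTriangulation K) (φ ψ : F) :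
    (mirrorCone K φ ψ).ncard =
      (Finset.univ.filter fun u : CoxVar → Fˣ => mirrorPoly φ ψ (fun m => (u m : F)) = 0).card +
      ∑ τ ∈ coxFaces K,
        (Finset.univ.filter fun x : CoxVar → F => zeroSet x = τ ∧ mirrorPoly φ ψ x = 0).card := by
  have hne : ∅ ∉ coxFaces K := fun h => Finset.not_nonempty_empty (nonempty_of_mem_coxFaces h)
  rw [Set.ncard_eq_toFinset_card', Finset.card_eq_sum_card_fiberwise (f := zeroSet)
    (t := insert ∅ (coxFaces K)), Finset.sum_insert hne]
  · congr 1
    · symm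
      refine Finset.card_bij (fun u _ m => (u m : F)) ?_ ?_ ?_
      · intro u hu
        have hz : zeroSet (fun m => (u m : F)) = ∅ := by
          ext m
          simp [mem_zeroSet]
        simp only [Finset.mem_filter, Finset.mem_univ, true_and, Set.mem_toFinset] at hu ⊢
        exact ⟨⟨(isAdmissible_iff hK _).2 (Or.inl hz), hu⟩, hz⟩
      · intro u _ v _ h
        exact funext fun m => Units.ext (congrFun h m)
      · intro x hx
        simp only [Finset.mem_filter, Set.mem_toFinset] at hx
        obtain ⟨⟨-, hP⟩, hz⟩ := hx
        have hx0 : ∀ m, x m ≠ 0 := fun m h => by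
          rw [← mem_zeroSet, hz] at h
          exact Finset.notMem_empty m h
        exact ⟨fun m => Units.mk0 (x m) (hx0 m), by simpa using hP, rfl⟩
    · refine Finset.sum_congr rfl fun τ hτ => ?_
      congr 1
      ext x
      simp only [Finset.mem_filter, Finset.mem_univ, true_and, Set.mem_toFinset]
      constructor
      · rintro ⟨⟨-, hP⟩, hz⟩
        exact ⟨hz, hP⟩
      · rintro ⟨hz, hP⟩
        exact ⟨⟨(isAdmissible_iff hK _).2 (Or.inr (hz ▸ hτ)), hP⟩, hz⟩
  · intro x hx
    simp only [Set.coe_toFinset] at hx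
    have := (isAdmissible_iff hK x).1 hx.1
    simpa using this

end Strata

/-! ### The contributions of the faces of the Newton polyhedron -/

section FaceSums

/-- The number of elements of `J` of weight one. -/
def numOuter (J : Finset (Fin 5)) : ℕ := (J.filter (· < 2)).card

/-- The number of elements of `J` of weight two. -/
def numInner (J : Finset (Fin 5)) : ℕ := (J.filter (2 ≤ ·)).card

/-- The numbers of vertices, edges and triangles in the interior of a face on which `r` coordinates
of weight one and `s` coordinates of weight two vanish. -/
def simplexTable : ℕ → ℕ → ℕ × ℕ × ℕ
  | 0, 2 => (9, 40, 32)
  | 1, 1 => (3, 18, 16)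
  | 2, 0 => (3, 18, 16)
  | 0, 3 => (7, 8, 0)
  | 1, 2 => (3, 4, 0)
  | 2, 1 => (3, 4, 0)
  | _, _ => (1, 0, 0)

/-- A finite computation confirming that the table solves the triangular system of `simplexCount_eq`
for every face. -/
theorem degreeCount_eq_simplexTable : ∀ J : Finset (Fin 5), 2 ≤ J.card → J ≠ Finset.univ →
    degreeCount 5 ![1, 1, 2, 2, 2] (fun i => decide (i ∈ J)) 8 =
      (simplexTable (numOuter J) (numInner J)).1 ∧
    degreeCount 5 ![1, 1, 2, 2, 2] (fun i => decide (i ∈ J)) 16 =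
      (simplexTable (numOuter J) (numInner J)).1 + (simplexTable (numOuter J) (numInner J)).2.1 ∧
    degreeCount 5 ![1, 1, 2, 2, 2] (fun i => decide (i ∈ J)) 24 =
      (simplexTable (numOuter J) (numInner J)).1 +
        2 * (simplexTable (numOuter J) (numInner J)).2.1 +
          (simplexTable (numOuter J) (numInner J)).2.2 := by
  decide +kernel

theorem numOuter_numInner : ∀ J : Finset (Fin 5), numOuter J + numInner J = J.card ∧
    numOuter J ≤ 2 ∧ numInner J ≤ 3 ∧ (0 ∈ J ∧ 1 ∈ J ↔ numOuter J = 2) ∧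
    (J = Finset.univ ↔ J.card = 5) := by
  decide +kernel

theorem card_filter_numOuter_numInner : ∀ r ∈ Finset.range 3, ∀ s ∈ Finset.range 4,
    (Finset.univ.filter fun J : Finset (Fin 5) => (numOuter J, numInner J) = (r, s)).card =
      Nat.choose 2 r * Nat.choose 3 s := by
  decide +kernel

theorem sum_finset_fin_five {R : Type*} [AddCommMonoid R] (f : ℕ → ℕ → R) :
    ∑ J : Finset (Fin 5), f (numOuter J) (numInner J) =
      ∑ r ∈ Finset.range 3, ∑ s ∈ Finset.range 4, (Nat.choose 2 r * Nat.choose 3 s) • f r s := by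
  rw [← Finset.sum_fiberwise_of_maps_to (g := fun J => (numOuter J, numInner J))
    (t := Finset.range 3 ×ˢ Finset.range 4), Finset.sum_product]
  · refine Finset.sum_congr rfl fun r hr => Finset.sum_congr rfl fun s hs => ?_
    rw [← card_filter_numOuter_numInner r hr s hs, ← Finset.sum_const]
    refine Finset.sum_congr rfl fun J hJ => ?_
    have := (Finset.mem_filter.1 hJ).2
    rw [Prod.mk.injEq] at this
    rw [this.1, this.2]
  · intro J _
    obtain ⟨-, h1, h2, -⟩ := numOuter_numInner J
    simp only [Finset.mem_product, Finset.mem_range]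
    omega

/-- The number of points in the strata of a face on which `r` coordinates of weight one and `s`
coordinates of weight two vanish. -/
def facePoints {R : Type*} [Ring R] (Q χ : R) : ℕ → ℕ → R
  | 0, 2 => 9 * Q ^ 2 + 40 * Q + 32
  | 1, 1 => 3 * Q ^ 2 + 18 * Q + 16
  | 2, 0 => (1 + χ) * (3 * Q ^ 2 + 18 * Q + 16)
  | 0, 3 => (Q - 1) * (7 * Q + 8)
  | 1, 2 => (Q - 1) * (3 * Q + 4)
  | 2, 1 => (Q - 1 - χ) * (3 * Q + 4)
  | 1, 3 => Q ^ 2 - Q + 1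
  | 2, 2 => Q ^ 2 - Q + 1 + χ
  | _, _ => 0

variable {F : Type*} [Field F] [Fintype F] {K : Geometry.SimplicialComplex ℝ (Fin 5 → ℝ)}
  {𝕂 : Type*} [Field 𝕂] [CharZero 𝕂]

open Classical in
-- Each stratum has `faceCount J φ / Q ^ τ.card` solutions, so only the numbers of simplices of each
-- size matter. No simplex has `J` empty or everything.
theorem sum_strata_eq (hK : IsFineTriangulation K) (hF : ringChar F ≠ 2) (φ ψ : F)
    (J : Finset (Fin 5)) :
    ∑ τ ∈ (coxFaces K).filter (fun τ => zeroCoords τ = J),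
      ((Finset.univ.filter fun x : CoxVar → F => zeroSet x = τ ∧ mirrorPoly φ ψ x = 0).card : 𝕂) =
    Nat.card (coxGroup F) * facePoints (Fintype.card Fˣ : 𝕂)
      ((quadraticChar F (φ ^ 2 - 1) : ℤ) : 𝕂) (numOuter J) (numInner J) := by
  obtain ⟨hrs, hr, hs, hr2, huniv⟩ := numOuter_numInner J
  have hQ : (Fintype.card Fˣ : 𝕂) ≠ 0 := Nat.cast_ne_zero.2 Fintype.card_ne_zero
  have hq : (Fintype.card Fˣ : 𝕂) + 1 ≠ 0 := by
    rw [card_units_cast_add_one]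
    exact Nat.cast_ne_zero.2 Fintype.card_ne_zero
  have hG : (Fintype.card (CoxVar → Fˣ) : 𝕂) = Nat.card (coxGroup F) * Fintype.card Fˣ ^ 4 := by
    exact_mod_cast (card_coxGroup (F := F)).symm
  have hst : ∀ τ ∈ (coxFaces K).filter (fun τ => zeroCoords τ = J),
      ((Finset.univ.filter fun x : CoxVar → F =>
        zeroSet x = τ ∧ mirrorPoly φ ψ x = 0).card : 𝕂) =
      (faceCount J φ : 𝕂) / (Fintype.card Fˣ : 𝕂) ^ τ.card := by
    intro τ hτ
    obtain ⟨hτ, hz⟩ := Finset.mem_filter.1 hτ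
    rw [eq_div_iff (pow_ne_zero _ hQ), ← hz]
    exact_mod_cast card_stratum φ ψ (nonempty_of_mem_coxFaces hτ)
  rw [Finset.sum_congr rfl hst]
  by_cases hJ : J = Finset.univ
  · have h5 : numOuter J = 2 ∧ numInner J = 3 := by
      have := huniv.1 hJ
      omega
    rw [h5.1, h5.2, Finset.sum_eq_zero]
    · simp [facePoints]
    · intro τ hτ
      obtain ⟨hτ, hz⟩ := Finset.mem_filter.1 hτ
      obtain ⟨m, hm⟩ := nonempty_of_mem_coxFaces hτ
      have h : ∀ j, m.1 j = 0 := fun j => by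
        have : j ∈ zeroCoords τ := by rw [hz, hJ]; exact Finset.mem_univ j
        exact mem_zeroCoords.1 this m hm
      have := m.weight_eq
      simp [h] at this
  by_cases h0 : J.card = 0
  · have h5 : numOuter J = 0 ∧ numInner J = 0 := by omega
    rw [h5.1, h5.2, Finset.sum_eq_zero]
    · simp [facePoints]
    · intro τ hτ
      obtain ⟨hτ, hz⟩ := Finset.mem_filter.1 hτ
      obtain ⟨j, hj⟩ := exists_coord_eq_zero hK hτ
      have hj' : j ∈ J := hz ▸ mem_zeroCoords.2 hj
      rw [Finset.card_eq_zero.1 h0] at hj'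
      exact absurd hj' (Finset.notMem_empty j)
  have hne5 : J.card ≠ 5 := fun h => hJ (huniv.2 h)
  set Q : 𝕂 := (Fintype.card Fˣ : 𝕂) with hQdef
  set χ : 𝕂 := ((quadraticChar F (φ ^ 2 - 1) : ℤ) : 𝕂) with hχ
  by_cases h1 : J.card = 1
  · have h2 := congrArg (Int.cast : ℤ → 𝕂) (faceCount_of_notMem J φ (by rw [hr2]; omega))
    rw [h1] at h2
    push_cast at h2
    rw [← card_units_cast_add_one (F := F)] at h2
    -- For one coordinate the general count has the factor `Q ^ 1 + (-1) ^ 1 * Q = 0`.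
    have h3 : (faceCount J φ : 𝕂) = 0 := by
      have h4 : (Q + 1) * (faceCount J φ * Q ^ 1) = 0 := by rw [h2]; ring
      simpa [hq, hQ] using h4
    rw [h3]
    have h5 : (numOuter J = 0 ∧ numInner J = 1) ∨ (numOuter J = 1 ∧ numInner J = 0) := by omega
    rcases h5 with ⟨ha, hb⟩ | ⟨ha, hb⟩ <;> simp [ha, hb, facePoints]
  have h2 : 2 ≤ J.card := by omega
  obtain ⟨e1, e2, e3⟩ := degreeCount_eq_simplexTable J h2 hJ
  obtain ⟨s1, s2, s3⟩ := simplexCount_eq hK J h2 _ _ _ e1 e2 e3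
  rw [sum_faces_eq J h2 fun t => (faceCount J φ : 𝕂) / Q ^ t, s1, s2, s3]
  have hmem : numOuter J = 2 → (Q + 1) * (faceCount J φ * Q ^ J.card) =
      (Q ^ 2 * (Q ^ numInner J - (-1) ^ numInner J) +
        Q * (1 + χ) * (-1) ^ numInner J * (Q + 1)) * (Nat.card (coxGroup F) * Q ^ 4) := by
    intro h
    have h3 := congrArg (Int.cast : ℤ → 𝕂) (faceCount_of_mem hF J φ (hr2.2 h).1 (hr2.2 h).2 hJ
      (numInner J) (by omega))
    push_cast at h3
    rw [← card_units_cast_add_one (F := F), hG] at h3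
    exact h3
  have hnot : numOuter J ≠ 2 → (Q + 1) * (faceCount J φ * Q ^ J.card) =
      (Q ^ J.card + (-1) ^ J.card * Q) * (Nat.card (coxGroup F) * Q ^ 4) := by
    intro h
    have h3 := congrArg (Int.cast : ℤ → 𝕂) (faceCount_of_notMem J φ (mt hr2.1 h))
    push_cast at h3
    rw [← card_units_cast_add_one (F := F), hG] at h3
    exact h3
  have hdiv : ∀ E : 𝕂, (Q + 1) * (faceCount J φ * Q ^ J.card) = E →
      (faceCount J φ : 𝕂) = E / ((Q + 1) * Q ^ J.card) := fun E h => by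
    rw [eq_div_iff (mul_ne_zero hq (pow_ne_zero _ hQ)), ← h]
    ring
  have hcases : (numOuter J = 0 ∧ numInner J = 2) ∨ (numOuter J = 0 ∧ numInner J = 3) ∨
      (numOuter J = 1 ∧ numInner J = 1) ∨ (numOuter J = 1 ∧ numInner J = 2) ∨
      (numOuter J = 1 ∧ numInner J = 3) ∨ (numOuter J = 2 ∧ numInner J = 0) ∨
      (numOuter J = 2 ∧ numInner J = 1) ∨ (numOuter J = 2 ∧ numInner J = 2) := by omega
  rcases hcases with ⟨ha, hb⟩ | ⟨ha, hb⟩ | ⟨ha, hb⟩ | ⟨ha, hb⟩ | ⟨ha, hb⟩ | ⟨ha, hb⟩ | ⟨ha, hb⟩ |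
    ⟨ha, hb⟩
  all_goals
    rw [ha, hb] at hrs
    first
    | rw [hdiv _ (hnot (by omega))]
    | rw [hdiv _ (hmem ha)]
    rw [ha, hb, ← hrs]
    simp only [simplexTable, facePoints, nsmul_eq_mul]
    push_cast
    field_simp
    try ring

open Classical in
theorem mirrorCount_eq (hK : IsFineTriangulation K) (hF : ringChar F ≠ 2) (φ ψ : F)
    (Θ : AddChar F 𝕂) (hΘ : Θ ≠ 1) (ω : Fˣ →* 𝕂ˣ) (hω : Function.Injective ω) :
    (mirrorCount K φ ψ : 𝕂) = 1 + 83 * (Fintype.card F : 𝕂) + 83 * (Fintype.card F : 𝕂) ^ 2 +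
      (Fintype.card F : 𝕂) ^ 3 + N0 Θ ω φ ψ + 3 * (Fintype.card F : 𝕂) *
        ((Fintype.card F : 𝕂) + 1) * ((quadraticChar F (φ ^ 2 - 1) : ℤ) : 𝕂) := by
  have hQ : (Fintype.card Fˣ : 𝕂) ≠ 0 := Nat.cast_ne_zero.2 Fintype.card_ne_zero
  have hq : (Fintype.card Fˣ : 𝕂) + 1 ≠ 0 := by
    rw [card_units_cast_add_one]
    exact Nat.cast_ne_zero.2 Fintype.card_ne_zero
  have hG0 : (Nat.card (coxGroup F) : 𝕂) ≠ 0 := Nat.cast_ne_zero.2 Nat.card_pos.ne'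
  have hG : (Fintype.card (CoxVar → Fˣ) : 𝕂) = Nat.card (coxGroup F) * Fintype.card Fˣ ^ 4 := by
    exact_mod_cast (card_coxGroup (F := F)).symm
  have h1 := congrArg (Nat.cast : ℕ → 𝕂) (mirrorCount_mul_card hK φ ψ)
  have h2 := congrArg (Nat.cast : ℕ → 𝕂) (card_mirrorPoly_units φ ψ)
  rw [ncard_mirrorCone hK, Nat.cast_mul, Nat.cast_add, Nat.cast_sum] at h1
  rw [Nat.cast_mul, Nat.cast_mul, Nat.cast_pow, hG] at h2
  rw [← Finset.sum_fiberwise (coxFaces K) zeroCoords,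
    Finset.sum_congr rfl fun J _ => sum_strata_eq (𝕂 := 𝕂) hK hF φ ψ J, ← Finset.mul_sum,
    sum_finset_fin_five] at h1
  simp only [Finset.sum_range_succ, Finset.sum_range_zero, facePoints, nsmul_eq_mul] at h1
  rw [N0_eq hF Θ hΘ ω hω, ← card_units_cast_add_one (F := F)]
  set Q : 𝕂 := (Fintype.card Fˣ : 𝕂) with hQdef
  set χ : 𝕂 := ((quadraticChar F (φ ^ 2 - 1) : ℤ) : 𝕂) with hχ
  -- After division by the group order the torus contributes its zeros over `Q`, the leading term of
  -- `N0_eq`; the rest is a polynomial identity in `Q = q - 1` and `χ`.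
  rw [← eq_div_iff (pow_ne_zero _ hQ)] at h2
  rw [h2, ← eq_div_iff hG0] at h1
  rw [h1]
  norm_num [Nat.choose]
  field_simp
  ring

end FaceSums

/-! ### The main theorem -/

section Main

/-- By Euler's criterion: `(p ^ s - 1) / 2` is `(p - 1) / 2` times `1 + p + ⋯ + p ^ (s - 1)`, and
the latter sum has the parity of `s` as `p` is odd. Values in `{0, 1, -1}` are recovered from their
images in `F`. -/
theorem quadraticChar_algebraMap (p : ℕ) [Fact p.Prime] (hp : p ≠ 2) {F : Type*} [Field F]
    [Fintype F] [DecidableEq F] [Algebra (ZMod p) F] (s : ℕ) (hs : 1 ≤ s)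
    (hcard : Fintype.card F = p ^ s) (x : ZMod p) :
    quadraticChar F (algebraMap (ZMod p) F x) = quadraticChar (ZMod p) x ^ s := by
  have hpodd : p % 2 = 1 := ((Fact.out : p.Prime).eq_two_or_odd).resolve_left hp
  have : CharP F p := charP_of_injective_algebraMap (algebraMap (ZMod p) F).injective p
  have hF : ringChar F ≠ 2 := by rwa [ringChar.eq F p]
  have hZ : ringChar (ZMod p) ≠ 2 := by rwa [ZMod.ringChar_zmod_n]
  by_cases hx : x = 0
  · simp [hx, Nat.one_le_iff_ne_zero.1 hs]
  have hx' : algebraMap (ZMod p) F x ≠ 0 := by simpa using hx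
  have h1 := quadraticChar_eq_pow_of_char_ne_two' hF (algebraMap (ZMod p) F x)
  have h2 := quadraticChar_eq_pow_of_char_ne_two' hZ x
  rw [ZMod.card] at h2
  have hgeom : p ^ s / 2 = p / 2 * ∑ i ∈ Finset.range s, p ^ i := by
    have h3 := geom_sum_mul_add (p - 1) s
    rw [Nat.sub_add_cancel (Fact.out : p.Prime).one_le] at h3
    obtain ⟨k, rfl⟩ : ∃ k, p = 2 * k + 1 := ⟨p / 2, by omega⟩
    rw [← h3, show (2 * k + 1) / 2 = k by omega, show 2 * k + 1 - 1 = 2 * k by omega,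
      show (∑ i ∈ Finset.range s, (2 * k + 1) ^ i) * (2 * k) + 1 =
        2 * (k * ∑ i ∈ Finset.range s, (2 * k + 1) ^ i) + 1 by ring]
    omega
  have hpar : (∑ i ∈ Finset.range s, p ^ i) % 2 = s % 2 := by
    rw [Finset.sum_nat_mod]
    simp [Nat.pow_mod, hpodd]
  have h5 : quadraticChar (ZMod p) x ^ (∑ i ∈ Finset.range s, p ^ i) =
      quadraticChar (ZMod p) x ^ s := by
    rw [← Nat.div_add_mod (∑ i ∈ Finset.range s, p ^ i) 2, hpar, pow_add, pow_mul,
      quadraticChar_sq_one hx, one_pow]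
    conv_rhs => rw [← Nat.div_add_mod s 2, pow_add, pow_mul, quadraticChar_sq_one hx, one_pow]
  have h6 : ((quadraticChar F (algebraMap (ZMod p) F x) : ℤ) : F) =
      ((quadraticChar (ZMod p) x ^ s : ℤ) : F) := by
    rw [h1, hcard, hgeom, pow_mul, ← map_pow, ← h2, ← h5, map_intCast, Int.cast_pow]
  refine Int.cast_injOn_of_ringChar_ne_two hF ?_ ?_ h6
  · rcases quadraticChar_dichotomy hx' with h | h <;> simp [h]
  · rcases quadraticChar_dichotomy hx with h | h
    · simp [h]
    · rcases neg_one_pow_eq_or ℤ s with h' | h' <;> simp [h, h']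

/-- The number of points of the mirror octic over the field with `p ^ s` elements. -/
theorem mirrorCount_eq_of_card (p : ℕ) [Fact p.Prime] (hp : p ≠ 2)
    {K : Geometry.SimplicialComplex ℝ (Fin 5 → ℝ)} (hK : IsFineTriangulation K) (φ ψ : ZMod p)
    {𝕂 : Type*} [Field 𝕂] [CharZero 𝕂] (s : ℕ) (hs : 1 ≤ s) {F : Type*} [Field F] [Fintype F]
    [Algebra (ZMod p) F] (hcard : Fintype.card F = p ^ s) (Θ : AddChar F 𝕂) (hΘ : Θ ≠ 1)
    (ω : Fˣ →* 𝕂ˣ) (hω : Function.Injective ω) :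
    (mirrorCount K (algebraMap (ZMod p) F φ) (algebraMap (ZMod p) F ψ) : 𝕂) =
      1 + 83 * (p : 𝕂) ^ s + 83 * ((p : 𝕂) ^ s) ^ 2 + ((p : 𝕂) ^ s) ^ 3 +
        N0 Θ ω (algebraMap (ZMod p) F φ) (algebraMap (ZMod p) F ψ) +
        3 * (p : 𝕂) ^ s * ((p : 𝕂) ^ s + 1) *
          ((quadraticChar (ZMod p) (φ ^ 2 - 1) : ℤ) : 𝕂) ^ s := by
  classical
  have : CharP F p := charP_of_injective_algebraMap (algebraMap (ZMod p) F).injective p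
  have hF : ringChar F ≠ 2 := by rwa [ringChar.eq F p]
  have h1 := mirrorCount_eq hK hF (algebraMap (ZMod p) F φ) (algebraMap (ZMod p) F ψ) Θ hΘ ω hω
  have h2 := quadraticChar_algebraMap p hp s hs hcard (φ ^ 2 - 1)
  rw [map_sub, map_pow, map_one] at h2
  rw [h1, hcard, Nat.cast_pow, ← Int.cast_pow, ← h2]

end Main

end MirrorOctic

end

theorem mainTheorem2 (p : ℕ) [Fact p.Prime] (hp : p ≠ 2)
    (K : Geometry.SimplicialComplex ℝ (Fin 5 → ℝ)) (hK : MirrorOctic.IsFineTriangulation K)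
    (φ ψ : ZMod p) (𝕂 : Type*) [Field 𝕂] [CharZero 𝕂] :
    (∀ s : ℕ, 1 ≤ s → ∀ (F : Type*) [Field F] [Fintype F] [Algebra (ZMod p) F],
      Fintype.card F = p ^ s →
      ∀ (Θ : AddChar F 𝕂) (ω : Fˣ →* 𝕂ˣ), Θ ≠ 1 → Function.Injective ω →
        (MirrorOctic.mirrorCount K (algebraMap (ZMod p) F φ) (algebraMap (ZMod p) F ψ) : 𝕂) =
          1 + 83 * (p : 𝕂) ^ s + 83 * ((p : 𝕂) ^ s) ^ 2 + ((p : 𝕂) ^ s) ^ 3 +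
            MirrorOctic.N0 Θ ω (algebraMap (ZMod p) F φ) (algebraMap (ZMod p) F ψ) +
            3 * (p : 𝕂) ^ s * ((p : 𝕂) ^ s + 1) *
              ((quadraticChar (ZMod p) (φ ^ 2 - 1) : ℤ) : 𝕂) ^ s) ∧
    (∀ (F : ℕ → Type*) [∀ s, Field (F s)] [∀ s, Fintype (F s)] [∀ s, Algebra (ZMod p) (F s)],
      (∀ s, 1 ≤ s → Fintype.card (F s) = p ^ s) →
      ∀ (Θ : ∀ s, AddChar (F s) 𝕂) (ω : ∀ s, (F s)ˣ →* 𝕂ˣ),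
        (∀ s, 1 ≤ s → Θ s ≠ 1) → (∀ s, 1 ≤ s → Function.Injective (ω s)) →
        MirrorOctic.zetaSeries (fun s => (MirrorOctic.mirrorCount K
              (algebraMap (ZMod p) (F s) φ) (algebraMap (ZMod p) (F s) ψ) : 𝕂)) *
            ((1 - X) * (1 - (p : 𝕂⟦X⟧) * X) ^ 83 * (1 - (p : 𝕂⟦X⟧) ^ 2 * X) ^ 83 *
              (1 - ((quadraticChar (ZMod p) (φ ^ 2 - 1) : ℤ) : 𝕂⟦X⟧) * (p : 𝕂⟦X⟧) * X) ^ 3 *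
              (1 - ((quadraticChar (ZMod p) (φ ^ 2 - 1) : ℤ) : 𝕂⟦X⟧) * (p : 𝕂⟦X⟧) ^ 2 * X) ^ 3 *
              (1 - (p : 𝕂⟦X⟧) ^ 3 * X)) =
          MirrorOctic.zetaSeries (fun s => MirrorOctic.N0 (Θ s) (ω s)
            (algebraMap (ZMod p) (F s) φ) (algebraMap (ZMod p) (F s) ψ))) := by
  refine ⟨fun s hs F _ _ _ hcard Θ ω hΘ hω =>
    MirrorOctic.mirrorCount_eq_of_card p hp hK φ ψ s hs hcard Θ hΘ ω hω,
    fun F _ _ _ hcard Θ ω hΘ hω => ?_⟩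
  have h := MirrorOctic.zetaSeries_mul_eq_of_count (𝕂 := 𝕂) p
    ((quadraticChar (ZMod p) (φ ^ 2 - 1) : ℤ) : 𝕂) fun s hs =>
      MirrorOctic.mirrorCount_eq_of_card p hp hK φ ψ s hs (hcard s hs) (Θ s) (hΘ s hs) (ω s)
        (hω s hs)
  rwa [map_natCast, map_intCast] at h
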